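/- Let $n\ge 1$ and let $q,s,t\in\mathbb C$ with $0<|q|,|s|,|t|<1$. For $\alpha\in\mathbb Z^n$ put $|\alpha|=|\alpha_1|+\dots+|\alpha_n|$, and let $\operatorname{sgn}(a)=1$ for $a\ge 0$ and $\operatorname{sgn}(a)=-1$ for $a<0$. Let $\pi_\alpha\in S_n$ be the permutation such that $\pi_\alpha(1),\dots,\pi_\alpha(n)$ lists the positions $1,\dots,n$ by decreasing $|\alpha_i|$, where among the positions with the same value of $|\alpha_i|$ those with $\alpha_i\ge 0$ come first, in increasing order, followed by those with $\alpha_i<0$, in decreasing order. Define the interpolation point $\overline\alpha\in(\mathbb C^*)^n$ (in the principal specialization) by $$\overline\alpha_i=q^{\alpha_i}\bigl(st^{\,n-\pi_\alpha^{-1}(i)}\bigr)^{\operatorname{sgn}(\alpha_i)}\qquad(1\le i\le n).$$ Let $\mathcal P_n=\mathbb C[x_1^{\pm1},\dots,x_n^{\pm1}]$; a Laurent polynomial has degree $\le d$ if only monomials $x^\gamma$ with $|\gamma|\le d$ occur in it. The nonsymmetric $BC$-type interpolation Macdonald polynomial $G_\alpha=G_\alpha(x;q,s,t)$ is the Laurent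 polynomial of degree $\le|\alpha|$ with $G_\alpha(\overline\alpha)=1$ and $G_\alpha(\overline\beta)=0$ for all $\beta\in\mathbb Z^n$ with $|\beta|\le|\alpha|$, $\beta\ne\alpha$. Let $s_j$ ($1\le j<n$) act on $\mathbb Z^n$ by interchanging the coordinates $j$ and $j+1$, let $s_n$ change the sign of the $n$-th coordinate, and let them act on $\mathcal P_n$ by $x^\gamma\mapsto x^{s_j\gamma}$. The Demazure–Lusztig operators on $\mathcal P_n$, with Hecke parameter $t$ at the long simple roots and $-1$ at the short simple root, are $$H_j^{(t)}=t+\frac{x_j-tx_{j+1}}{x_j-x_{j+1}}(s_j-1)\quad(1\le j<n),\qquad H_n^{(s)}=-1+\frac{(1-sx_n^{-1})(1-s^{-1}x_n^{-1})}{1-x_n^{-2}}(s_n-1).$$ Theorem. For every $\alpha\in\mathbb Z^n$ the Laurent polynomial $G_\alpha$ exists and is unique, and the following holds. (a) Let $1\le j<n$. If $s_j\alpha=\alpha$, then $H_j^{(t)}G_\alpha=tG_\alpha$. If $s_j\alpha\ne\alpha$, then $\overline\alpha_{j+1}\ne\overline\alpha_j$ and $$H_j^{(t)}G_\alpha=-G_\alpha+\frac{\overline\alpha_{j+1}-t\overline\alpha_j}{\overline\alpha_{j+1}-\overline\alpha_j}\bigl(G_{s_j\alpha}+G_\alpha\bigr).$$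 (b) One has $\overline\alpha_n^2\ne1$ and $$H_n^{(s)}G_\alpha=-G_\alpha+\frac{(1-s\overline\alpha_n)(1-s^{-1}\overline\alpha_n)}{1-\overline\alpha_n^2}\bigl(G_{s_n\alpha}+G_\alpha\bigr).$$ In particular, if $s_n\alpha=\alpha$, then $H_n^{(s)}G_\alpha=-G_\alpha$. -/

import Mathlib

open scoped BigOperators

namespace NonsymInterp

noncomputable section

/-! ### Combinatorics of `ℤⁿ` -/

/-- The weight `|α| = |α₁| + ⋯ + |αₙ|` of `α ∈ ℤⁿ`. -/
def weight {n : ℕ} (α : Fin n → ℤ) : ℕ := ∑ i, (α i).natAbs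

/-- The sign function with `sgn a = 1` for `a ≥ 0` and `sgn a = -1` for `a < 0`. -/
def sgn (a : ℤ) : ℤ := if 0 ≤ a then 1 else -1

/-- The sorting key of the position `i` of `α`: entries are listed by decreasing absolute value;
among the entries with a common absolute value, the nonnegative ones come first, by increasing
position, followed by the negative ones, by decreasing position. -/
def sortKey {n : ℕ} (α : Fin n → ℤ) (i : Fin n) : ℤ ×ₗ ℤ :=
  toLex (-|α i|, if 0 ≤ α i then (i : ℤ) else 2 * (n : ℤ) - (i : ℤ))

/-- The permutation `π_α`: `sortPerm α k` is the position listed as number `k` in the order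
described in `sortKey`. It is the permutation part of the shortest element `w_α = σ_α π_α` of the
hyperoctahedral group which sends the partition `α⁺` in the orbit of `α` to `α`. -/
def sortPerm {n : ℕ} (α : Fin n → ℤ) : Equiv.Perm (Fin n) := Tuple.sort (sortKey α)

/-- The principal specialization `τᵢ = s t^(n-i)` for `i = 1, …, n`.
The index `i : Fin n` is counted from `0`, so that it stands for the number `i + 1`. -/
def principalPoint {n : ℕ} (s t : ℂ) (i : Fin n) : ℂ := s * t ^ (n - ((i : ℕ) + 1))

/-- The interpolation point `ᾱ(q, τ)`, with coordinates `ᾱᵢ = q^αᵢ (τ_{π_α⁻¹(i)})^sgn(αᵢ)`. -/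
def interpPoint {n : ℕ} (q : ℂ) (τ : Fin n → ℂ) (α : Fin n → ℤ) (i : Fin n) : ℂ :=
  q ^ (α i) * (τ ((sortPerm α).symm i)) ^ (sgn (α i))

/-! ### Laurent polynomials -/

/-- The algebra `ℂ[x₁^±1, …, xₙ^±1]` of Laurent polynomials, as the group algebra of `ℤⁿ`. -/
abbrev LaurentPoly (n : ℕ) : Type := AddMonoidAlgebra ℂ (Fin n → ℤ)

/-- The Laurent monomial `x^γ`. -/
def mono {n : ℕ} (γ : Fin n → ℤ) : LaurentPoly n := AddMonoidAlgebra.single γ 1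

/-- The variable `xᵢ`. -/
def X {n : ℕ} (i : Fin n) : LaurentPoly n := mono (Pi.single i 1)

/-- The inverse variable `xᵢ⁻¹`. -/
def Xinv {n : ℕ} (i : Fin n) : LaurentPoly n := mono (Pi.single i (-1))

/-- The value of a Laurent polynomial at a point with nonzero coordinates. -/
def evalAt {n : ℕ} (x : Fin n → ℂ) (f : LaurentPoly n) : ℂ :=
  f.coeff.sum fun γ c => c * ∏ i, x i ^ γ i

/-- The Laurent polynomial `f` has degree at most `d`: only monomials of weight at most `d`
occur in it. -/
def DegLE {n : ℕ} (d : ℕ) (f : LaurentPoly n) : Prop :=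
  ∀ γ : Fin n → ℤ, f.coeff γ ≠ 0 → weight γ ≤ d

/-! ### Interpolation polynomials -/

/-- `f` solves the interpolation problem of degree `α`: it has degree at most `|α|`, takes the
value `1` at `ᾱ`, and vanishes at `β̄` for all `β ≠ α` with `|β| ≤ |α|`. -/
def IsInterp {n : ℕ} (q : ℂ) (τ : Fin n → ℂ) (α : Fin n → ℤ) (f : LaurentPoly n) : Prop :=
  DegLE (weight α) f ∧
  evalAt (interpPoint q τ α) f = 1 ∧
  ∀ β : Fin n → ℤ, weight β ≤ weight α → β ≠ α → evalAt (interpPoint q τ β) f = 0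

/-- The nonsymmetric interpolation Laurent polynomial `G_α(x; q, s, t)` in the principal
specialization: the solution of the interpolation problem of degree `α` with `τᵢ = s t^(n-i)`. -/
def G {n : ℕ} (q s t : ℂ) (α : Fin n → ℤ) : LaurentPoly n :=
  Classical.epsilon (IsInterp q (principalPoint s t) α)

/-! ### Simple reflections -/

/-- The reflection of `ℤⁿ` which interchanges the coordinates `i` and `j`. -/
def swapRefl {n : ℕ} (i j : Fin n) : (Fin n → ℤ) →+ (Fin n → ℤ) where
  toFun α := fun k => α (Equiv.swap i j k)
  map_zero' := rfl
  map_add' _ _ := rfl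

/-- The reflection of `ℤⁿ` which changes the sign of the coordinate `i`. -/
def signRefl {n : ℕ} (i : Fin n) : (Fin n → ℤ) →+ (Fin n → ℤ) where
  toFun α := fun k => if k = i then -α k else α k
  map_zero' := by ext k; simp
  map_add' α β := by
    ext k
    by_cases h : k = i
    · simp [h]; ring
    · simp [h]

/-- The simple reflections `s₁, …, s_m` of type `B_{m+1}` other than the last one. -/
def simpleRefl {m : ℕ} (j : Fin m) : (Fin (m + 1) → ℤ) →+ (Fin (m + 1) → ℤ) :=
  swapRefl j.castSucc j.succ

/-- The last simple reflection of type `B_{m+1}`, that of the short simple root. -/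
def lastRefl (m : ℕ) : (Fin (m + 1) → ℤ) →+ (Fin (m + 1) → ℤ) := signRefl (Fin.last m)

/-- The action `x^γ ↦ x^(wγ)` on Laurent polynomials of an additive map `w` of `ℤⁿ`. -/
def act {n : ℕ} (w : (Fin n → ℤ) →+ (Fin n → ℤ)) : LaurentPoly n →ₐ[ℂ] LaurentPoly n :=
  AddMonoidAlgebra.mapDomainAlgHom ℂ ℂ w

/-! ### Divided differences -/

lemma mono_add {n : ℕ} (γ δ : Fin n → ℤ) : mono (γ + δ) = mono γ * mono δ := by
  simp [mono, AddMonoidAlgebra.single_mul_single]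

lemma mono_zero {n : ℕ} : mono (0 : Fin n → ℤ) = 1 := rfl

lemma mono_injective {n : ℕ} : Function.Injective (mono (n := n)) := by
  intro γ δ h
  exact AddMonoidAlgebra.single_left_injective one_ne_zero h

lemma act_mono {n : ℕ} (w : (Fin n → ℤ) →+ (Fin n → ℤ)) (γ : Fin n → ℤ) :
    act w (mono γ) = mono (w γ) := by
  simp [act, mono]

lemma X_sub_X_ne_zero {m : ℕ} (j : Fin m) :
    (X j.castSucc - X j.succ : LaurentPoly (m + 1)) ≠ 0 := by
  intro h
  have h1 := congrFun (mono_injective (sub_eq_zero.mp h)) j.castSucc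
  rw [Pi.single_eq_same, Pi.single_eq_of_ne (Fin.castSucc_lt_succ).ne] at h1
  exact one_ne_zero h1

lemma one_sub_Xinv_sq_ne_zero {n : ℕ} (i : Fin n) :
    (1 - Xinv i ^ 2 : LaurentPoly n) ≠ 0 := by
  intro h
  rw [← mono_zero, pow_two, Xinv, ← mono_add] at h
  have h1 := congrFun (mono_injective (sub_eq_zero.mp h)) i
  simp at h1

lemma dvd_mono_sub {n : ℕ} (w : (Fin n → ℤ) →+ (Fin n → ℤ)) (b : LaurentPoly n)
    (h : ∀ k, b ∣ act w (X k) - X k) (γ : Fin n → ℤ) : b ∣ mono (w γ) - mono γ := by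
  let S : AddSubgroup (Fin n → ℤ) :=
    { carrier := {γ | b ∣ mono (w γ) - mono γ}
      zero_mem' := by simp
      add_mem' := by
        intro γ δ hγ hδ
        have e : mono (w (γ + δ)) - mono (γ + δ) =
            mono (w γ) * (mono (w δ) - mono δ) + (mono (w γ) - mono γ) * mono δ := by
          rw [map_add, mono_add, mono_add]; ring
        simp only [Set.mem_ofPred_eq] at hγ hδ ⊢
        rw [e]
        exact dvd_add (hδ.mul_left _) (hγ.mul_right _)
      neg_mem' := by
        intro γ hγ
        have e1 : mono (w γ) * mono (-w γ) = 1 := by rw [← mono_add, add_neg_cancel, mono_zero]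
        have e2 : mono γ * mono (-γ) = 1 := by rw [← mono_add, add_neg_cancel, mono_zero]
        have e : mono (w (-γ)) - mono (-γ) =
            (mono (w γ) - mono γ) * (-(mono (-w γ) * mono (-γ))) := by
          rw [map_neg]
          linear_combination mono (-γ) * e1 - mono (-w γ) * e2
        simp only [Set.mem_ofPred_eq] at hγ ⊢
        rw [e]
        exact hγ.mul_right _ }
  have hS : ∀ k, Pi.single k 1 ∈ S := by
    intro k
    have := h k
    rw [X, act_mono] at this
    exact this
  have hγ : γ = ∑ k, γ k • (Pi.single k 1 : Fin n → ℤ) := by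
    ext i
    simp [Finset.sum_apply, Pi.single_apply]
  have : γ ∈ S := by
    rw [hγ]
    exact S.sum_mem fun k _ => S.zsmul_mem (hS k) _
  exact this

/-- If an additive map `w` moves every variable only by a multiple of `b`, then it moves every
Laurent polynomial only by a multiple of `b`. -/
lemma dvd_act_sub {n : ℕ} (w : (Fin n → ℤ) →+ (Fin n → ℤ)) (b : LaurentPoly n)
    (h : ∀ k, b ∣ act w (X k) - X k) (f : LaurentPoly n) : b ∣ act w f - f := by
  induction f using AddMonoidAlgebra.induction_linear with
  | zero => simp
  | add f g hf hg =>
    rw [map_add, add_sub_add_comm]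
    exact dvd_add hf hg
  | single γ c =>
    have e : (AddMonoidAlgebra.single γ c : LaurentPoly n) = c • mono γ := by
      simp [mono]
    rw [e, map_smul, act_mono, ← smul_sub]
    obtain ⟨g, hg⟩ := dvd_mono_sub w b h γ
    exact ⟨c • g, by rw [hg, mul_smul_comm]⟩

lemma dvd_simpleRefl {m : ℕ} (j : Fin m) (f : LaurentPoly (m + 1)) :
    (X j.castSucc - X j.succ) ∣ act (simpleRefl j) f - f := by
  apply dvd_act_sub
  intro k
  have e : simpleRefl j (Pi.single k 1) =
      Pi.single (Equiv.swap j.castSucc j.succ k) 1 := by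
    ext i
    simp only [simpleRefl, swapRefl, AddMonoidHom.coe_mk, ZeroHom.coe_mk, Pi.single_apply]
    refine if_congr ?_ rfl rfl
    rw [Equiv.swap_apply_eq_iff]
  have e' : act (simpleRefl j) (X k) = X (Equiv.swap j.castSucc j.succ k) := by
    rw [X, act_mono, e, X]
  rw [e']
  by_cases h1 : k = j.castSucc
  · subst h1
    rw [Equiv.swap_apply_left]
    exact ⟨-1, by ring⟩
  · by_cases h2 : k = j.succ
    · subst h2
      rw [Equiv.swap_apply_right]
    · rw [Equiv.swap_apply_of_ne_of_ne h1 h2, sub_self]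
      exact dvd_zero _

lemma dvd_lastRefl {m : ℕ} (f : LaurentPoly (m + 1)) :
    (1 - Xinv (Fin.last m) ^ 2) ∣ act (lastRefl m) f - f := by
  apply dvd_act_sub
  intro k
  by_cases h : k = Fin.last m
  · subst h
    have e : lastRefl m (Pi.single (Fin.last m) 1) = Pi.single (Fin.last m) (-1) := by
      ext i
      by_cases hi : i = Fin.last m
      · subst hi; simp [lastRefl, signRefl]
      · simp [lastRefl, signRefl, hi]
    have e2 : X (Fin.last m) * Xinv (Fin.last m) = 1 := by
      rw [X, Xinv, ← mono_add, ← Pi.single_add, add_neg_cancel, Pi.single_zero, mono_zero]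
    refine ⟨-X (Fin.last m), ?_⟩
    rw [X, act_mono, e]
    change Xinv (Fin.last m) - X (Fin.last m) = _ * (-X (Fin.last m))
    linear_combination -Xinv (Fin.last m) * e2
  · have e : lastRefl m (Pi.single k 1) = Pi.single k 1 := by
      ext i
      by_cases hi : i = Fin.last m
      · subst hi; simp [lastRefl, signRefl, Ne.symm h]
      · simp [lastRefl, signRefl, hi]
    rw [X, act_mono, e, sub_self]
    exact dvd_zero _

/-- The divided difference `f ↦ (w f - f) / b`, where `b ≠ 0` divides `w f - f` for every Laurent
polynomial `f`: its value at `f` is the Laurent polynomial `g` with `w f - f = b g`. -/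
def dividedDiff {n : ℕ} (w : (Fin n → ℤ) →+ (Fin n → ℤ)) (b : LaurentPoly n) (hb : b ≠ 0)
    (h : ∀ f, b ∣ act w f - f) : LaurentPoly n →ₗ[ℂ] LaurentPoly n where
  toFun f := (h f).choose
  map_add' f g := by
    apply mul_left_cancel₀ hb
    rw [mul_add, ← (h (f + g)).choose_spec, ← (h f).choose_spec, ← (h g).choose_spec, map_add]
    ring
  map_smul' c f := by
    apply mul_left_cancel₀ hb
    rw [RingHom.id_apply, mul_smul_comm, ← (h (c • f)).choose_spec, ← (h f).choose_spec,
      map_smul, smul_sub]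

lemma mul_dividedDiff {n : ℕ} (w : (Fin n → ℤ) →+ (Fin n → ℤ)) (b : LaurentPoly n) (hb : b ≠ 0)
    (h : ∀ f, b ∣ act w f - f) (f : LaurentPoly n) :
    b * dividedDiff w b hb h f = act w f - f :=
  (h f).choose_spec.symm

/-! ### Demazure–Lusztig operators -/

/-- The Demazure–Lusztig operator
`H_j^(t) = t + (x_j - t x_{j+1}) / (x_j - x_{j+1}) * (s_j - 1)` for `j` other than the last node,
in `m + 1` variables. -/
def demazureLusztig {m : ℕ} (t : ℂ) (j : Fin m) :
    LaurentPoly (m + 1) →ₗ[ℂ] LaurentPoly (m + 1) :=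
  t • LinearMap.id +
    LinearMap.mulLeft ℂ (X j.castSucc - t • X j.succ) ∘ₗ
      dividedDiff (simpleRefl j) (X j.castSucc - X j.succ) (X_sub_X_ne_zero j) (dvd_simpleRefl j)

/-- The Demazure–Lusztig operator
`H_n^(s) = -1 + (1 - s x_n⁻¹) (1 - s⁻¹ x_n⁻¹) / (1 - x_n⁻²) * (s_n - 1)` for the last node,
in `n = m + 1` variables, with Hecke parameter `-1`. -/
def demazureLusztigLast (m : ℕ) (s : ℂ) :
    LaurentPoly (m + 1) →ₗ[ℂ] LaurentPoly (m + 1) :=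
  -LinearMap.id +
    LinearMap.mulLeft ℂ
        ((1 - s • Xinv (Fin.last m)) * (1 - s⁻¹ • Xinv (Fin.last m))) ∘ₗ
      dividedDiff (lastRefl m) (1 - Xinv (Fin.last m) ^ 2)
        (one_sub_Xinv_sq_ne_zero (Fin.last m)) dvd_lastRefl

end

end NonsymInterp

open NonsymInterp

open scoped BigOperators

open NonsymInterp

namespace NonsymInterp

noncomputable section


/-! The identities are checked by interpolation. The operators preserve degree, and a Laurent
polynomial of degree at most `d` is determined by its values at the points `β̄` with `|β| ≤ d`. The
value of `H_j f` at `x` involves only `f(x)` and `f(s_j x)`. If `s_j β ≠ β`, the reflected point is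
the interpolation point of `s_j β`; if `s_j β = β`, the numerator of `H_j` vanishes at `β̄`, because
`β̄_j = t β̄_{j+1}`, or `β̄_n = s` for the last node. Hence `H_j G_α` can be nonzero only at `ᾱ` and
at the point of `s_j α`, and two scalars remain to be compared.

Existence and uniqueness come from a Newton scheme (`exists_interp_state`). It solves the
interpolation problem with arbitrary values. There are as many monomials of degree at most `d` as
points, so solvability for all values forces uniqueness (`eq_zero_of_evalAt_eq_zero`). The scheme
picks the lowest-ranked coordinate still free to move. As long as it keeps its initial state, its
value is one constant, so a linear factor splits the problem in two smaller ones. The bounds `|q|,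
|s|, |t| < 1` keep this factor nonzero elsewhere.

Degree preservation is `demazureLusztig_mem` and `demazureLusztigLast_mem`; the behaviour of the
points under reflections is reduced to counting in `corank`. -/

/-! ### Evaluation of Laurent polynomials -/

/-- Evaluation at a point with nonzero coordinates, as an algebra homomorphism. -/
def evalHom {n : ℕ} (x : Fin n → ℂ) (hx : ∀ i, x i ≠ 0) : LaurentPoly n →ₐ[ℂ] ℂ :=
  AddMonoidAlgebra.lift ℂ ℂ (Fin n → ℤ)
    { toFun := fun γ => ∏ i, x i ^ (γ.toAdd i)
      map_one' := by simp
      map_mul' := fun γ δ => by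
        simp only [toAdd_mul, Pi.add_apply, zpow_add₀ (hx _), Finset.prod_mul_distrib] }

lemma evalHom_apply {n : ℕ} (x : Fin n → ℂ) (hx : ∀ i, x i ≠ 0) (f : LaurentPoly n) :
    evalHom x hx f = evalAt x f := by
  rw [evalHom, AddMonoidAlgebra.lift_apply]
  rfl

lemma evalHom_mono {n : ℕ} (x : Fin n → ℂ) (hx : ∀ i, x i ≠ 0) (γ : Fin n → ℤ) :
    evalHom x hx (mono γ) = ∏ i, x i ^ γ i := by
  simp [evalHom, mono]

lemma evalHom_mono_single {n : ℕ} (x : Fin n → ℂ) (hx : ∀ i, x i ≠ 0) (i : Fin n) (z : ℤ) :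
    evalHom x hx (mono (Pi.single i z)) = x i ^ z := by
  rw [evalHom_mono, Finset.prod_eq_single i]
  · simp
  · intro j _ hj; simp [Pi.single_eq_of_ne hj]
  · simp

lemma evalHom_X {n : ℕ} (x : Fin n → ℂ) (hx : ∀ i, x i ≠ 0) (i : Fin n) :
    evalHom x hx (X i) = x i := by
  rw [X, evalHom_mono_single, zpow_one]

lemma evalHom_Xinv {n : ℕ} (x : Fin n → ℂ) (hx : ∀ i, x i ≠ 0) (i : Fin n) :
    evalHom x hx (Xinv i) = (x i)⁻¹ := by
  rw [Xinv, evalHom_mono_single, zpow_neg_one]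

/-- Substitution of monomials for the variables. -/
def subst {n k : ℕ} (φ : (Fin n → ℤ) →+ (Fin k → ℤ)) : LaurentPoly n →ₐ[ℂ] LaurentPoly k :=
  AddMonoidAlgebra.mapDomainAlgHom ℂ ℂ φ

lemma subst_mono {n k : ℕ} (φ : (Fin n → ℤ) →+ (Fin k → ℤ)) (γ : Fin n → ℤ) :
    subst φ (mono γ) = mono (φ γ) := by
  simp [subst, mono]

lemma single_eq_smul_mono {n : ℕ} (γ : Fin n → ℤ) (c : ℂ) :
    (AddMonoidAlgebra.single γ c : LaurentPoly n) = c • mono γ := by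
  simp [mono]

lemma evalHom_subst {n k : ℕ} (φ : (Fin n → ℤ) →+ (Fin k → ℤ)) (x : Fin k → ℂ)
    (hx : ∀ i, x i ≠ 0) (y : Fin n → ℂ) (hy : ∀ i, y i ≠ 0)
    (h : ∀ γ, ∏ i, x i ^ φ γ i = ∏ i, y i ^ γ i) (f : LaurentPoly n) :
    evalHom x hx (subst φ f) = evalHom y hy f := by
  induction f using AddMonoidAlgebra.induction_linear with
  | zero => simp
  | add f g hf hg => simp only [map_add, hf, hg]
  | single γ c =>
    rw [single_eq_smul_mono, map_smul, map_smul, map_smul, subst_mono, evalHom_mono,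
      evalHom_mono, h]

/-! ### Degrees -/

/-- The Laurent polynomials of degree at most `d`. -/
def degSubmodule (n d : ℕ) : Submodule ℂ (LaurentPoly n) :=
  Submodule.span ℂ (mono '' {γ : Fin n → ℤ | weight γ ≤ d})

lemma mono_mem_degSubmodule {n d : ℕ} {γ : Fin n → ℤ} (h : weight γ ≤ d) :
    mono γ ∈ degSubmodule n d :=
  Submodule.subset_span ⟨γ, h, rfl⟩

lemma eq_sum_smul_mono {n : ℕ} (f : LaurentPoly n) :
    f = ∑ γ ∈ f.coeff.support, f.coeff γ • mono γ := by
  conv_lhs => rw [← AddMonoidAlgebra.sum_coeff_single f]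
  rw [Finsupp.sum]
  exact Finset.sum_congr rfl fun γ _ => single_eq_smul_mono _ _

lemma mem_degSubmodule {n d : ℕ} {f : LaurentPoly n} : f ∈ degSubmodule n d ↔ DegLE d f := by
  constructor
  · intro hf
    induction hf using Submodule.span_induction with
    | mem f hf =>
      obtain ⟨γ, hγ, rfl⟩ := hf
      intro δ hδ
      by_cases h : γ = δ
      · subst h; exact hγ
      · simp [mono, h] at hδ
    | zero => intro δ hδ; simp at hδ
    | add f g _ _ hf hg =>
      intro δ hδ
      by_cases h : f.coeff δ = 0
      · refine hg δ fun h' => hδ ?_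
        simp [h, h']
      · exact hf δ h
    | smul c f _ hf =>
      intro δ hδ
      refine hf δ fun h => hδ ?_
      simp [h]
  · intro hf
    rw [eq_sum_smul_mono f]
    exact Submodule.sum_mem _ fun γ hγ => Submodule.smul_mem _ _
      (mono_mem_degSubmodule (hf γ (Finsupp.mem_support_iff.mp hγ)))

lemma map_mem_degSubmodule {n k d e : ℕ} (T : LaurentPoly n →ₗ[ℂ] LaurentPoly k)
    (h : ∀ γ, weight γ ≤ d → T (mono γ) ∈ degSubmodule k e) {f : LaurentPoly n}
    (hf : f ∈ degSubmodule n d) : T f ∈ degSubmodule k e := by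
  induction hf using Submodule.span_induction with
  | mem f hf =>
    obtain ⟨γ, hγ, rfl⟩ := hf
    exact h γ hγ
  | zero => simp
  | add f g _ _ hf hg => rw [map_add]; exact add_mem hf hg
  | smul c f _ hf => rw [map_smul]; exact Submodule.smul_mem _ _ hf


/-! ### The ranking of positions -/

/-- The position `j` comes after the position `i` in the list of positions of `γ`. -/
def After {n : ℕ} (γ : Fin n → ℤ) (i j : Fin n) : Prop := sortKey γ i < sortKey γ j

lemma after_iff {n : ℕ} (γ : Fin n → ℤ) (i j : Fin n) :
    After γ i j ↔ |γ j| < |γ i| ∨ |γ i| = |γ j| ∧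
      ((0 ≤ γ i ∧ γ j < 0) ∨ (0 ≤ γ i ∧ 0 ≤ γ j ∧ (i : ℕ) < j) ∨
        (γ i < 0 ∧ γ j < 0 ∧ (j : ℕ) < i)) := by
  rw [After, sortKey, sortKey, Prod.Lex.toLex_lt_toLex]
  have hi := i.isLt
  have hj := j.isLt
  dsimp only
  split_ifs with h1 h2 h2 <;> omega

lemma sortKey_injective {n : ℕ} (γ : Fin n → ℤ) : Function.Injective (sortKey γ) := by
  intro i j h
  by_contra hne
  have h1 : ¬ After γ i j := by rw [After, h]; exact lt_irrefl _
  have h2 : ¬ After γ j i := by rw [After, h]; exact lt_irrefl _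
  rw [after_iff] at h1 h2
  have : (i : ℕ) ≠ j := fun h => hne (Fin.ext h)
  omega

open scoped Classical in
/-- The number of positions listed after the position `i`. -/
def corank {n : ℕ} (γ : Fin n → ℤ) (i : Fin n) : ℕ :=
  (Finset.univ.filter fun j => After γ i j).card

/-- Replaces the sorting permutation by a count of later positions, which is easy to follow under
reflections. The `+ 1` is due to positions being numbered from zero. -/
lemma corank_eq {n : ℕ} (γ : Fin n → ℤ) (i : Fin n) :
    corank γ i = n - (((sortPerm γ).symm i : ℕ) + 1) := by
  have hm : StrictMono (sortKey γ ∘ sortPerm γ) :=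
    (Tuple.monotone_sort (sortKey γ)).strictMono_of_injective
      ((sortKey_injective γ).comp (sortPerm γ).injective)
  have h : corank γ i = (Finset.Ioi ((sortPerm γ).symm i)).card := by
    classical
    rw [corank]
    refine Finset.card_equiv (sortPerm γ).symm fun j => ?_
    rw [Finset.mem_filter, Finset.mem_Ioi, ← hm.lt_iff_lt]
    simp [After]
  rw [h, Fin.card_Ioi]
  omega

lemma corank_of_equiv {n k : ℕ} (e : Fin n ≃ Fin k) {γ : Fin n → ℤ} {δ : Fin k → ℤ} {i : Fin n}
    (h : ∀ j, After γ i j ↔ After δ (e i) (e j)) : corank γ i = corank δ (e i) := by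
  classical
  refine Finset.card_equiv e fun j => ?_
  simp [h j]

/-! ### Reflections and the ranking of positions. -/

lemma signRefl_apply_same {n : ℕ} (i : Fin n) (γ : Fin n → ℤ) : signRefl i γ i = -γ i := by
  simp [signRefl]

lemma signRefl_apply_of_ne {n : ℕ} {i j : Fin n} (h : j ≠ i) (γ : Fin n → ℤ) :
    signRefl i γ j = γ j := by
  simp [signRefl, h]

/-- Among equal absolute values the last position closes the nonnegative block or opens the negative
one. These are the same place in the list. -/
lemma corank_signRefl_last {n : ℕ} (γ : Fin (n + 1) → ℤ) (i : Fin (n + 1)) :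
    corank (signRefl (Fin.last n) γ) i = corank γ i := by
  refine (corank_of_equiv (Equiv.refl _) fun j => ?_)
  rw [after_iff, after_iff]
  simp only [Equiv.refl_apply]
  have hi := i.isLt
  have hj := j.isLt
  by_cases h1 : i = Fin.last n <;> by_cases h2 : j = Fin.last n
  · subst h1; subst h2; omega
  · subst h1
    have h2' : (j : ℕ) ≠ n := fun h => h2 (Fin.ext h)
    rw [signRefl_apply_same, signRefl_apply_of_ne h2, abs_neg, Fin.val_last]
    omega
  · subst h2
    have h1' : (i : ℕ) ≠ n := fun h => h1 (Fin.ext h)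
    rw [signRefl_apply_same, signRefl_apply_of_ne h1, abs_neg, Fin.val_last]
    omega
  · rw [signRefl_apply_of_ne h1, signRefl_apply_of_ne h2]

lemma simpleRefl_castSucc {m : ℕ} (j : Fin m) (γ : Fin (m + 1) → ℤ) :
    simpleRefl j γ j.castSucc = γ j.succ := by simp [simpleRefl, swapRefl]

lemma simpleRefl_succ {m : ℕ} (j : Fin m) (γ : Fin (m + 1) → ℤ) :
    simpleRefl j γ j.succ = γ j.castSucc := by simp [simpleRefl, swapRefl]

lemma simpleRefl_apply {m : ℕ} (j : Fin m) (γ : Fin (m + 1) → ℤ) (i : Fin (m + 1)) :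
    simpleRefl j γ i = γ (Equiv.swap j.castSucc j.succ i) := rfl

lemma simpleRefl_eq_self_iff {m : ℕ} (j : Fin m) (γ : Fin (m + 1) → ℤ) :
    simpleRefl j γ = γ ↔ γ j.castSucc = γ j.succ := by
  constructor
  · intro h
    rw [← simpleRefl_succ j γ, h]
  · intro h
    ext i
    rw [simpleRefl_apply]
    by_cases h1 : i = j.castSucc
    · subst h1; rw [Equiv.swap_apply_left, h]
    · by_cases h2 : i = j.succ
      · subst h2; rw [Equiv.swap_apply_right, h]
      · rw [Equiv.swap_apply_of_ne_of_ne h1 h2]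

/-- The order of positions breaks ties only between equal entries. Since the two swapped neighbours
carry different entries, the swap transports the whole ranking. -/
lemma corank_simpleRefl {m : ℕ} (j : Fin m) (γ : Fin (m + 1) → ℤ) (h : γ j.castSucc ≠ γ j.succ)
    (i : Fin (m + 1)) :
    corank (simpleRefl j γ) i = corank γ (Equiv.swap j.castSucc j.succ i) := by
  refine corank_of_equiv (Equiv.swap j.castSucc j.succ) fun k => ?_
  rw [after_iff, after_iff, simpleRefl_apply, simpleRefl_apply]
  have key : ∀ i : Fin (m + 1), (i = j.castSucc ∧ Equiv.swap j.castSucc j.succ i = j.succ) ∨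
      (i = j.succ ∧ Equiv.swap j.castSucc j.succ i = j.castSucc) ∨
      ((i : ℕ) ≠ j ∧ (i : ℕ) ≠ j + 1 ∧ Equiv.swap j.castSucc j.succ i = i) := by
    intro i
    by_cases h1 : i = j.castSucc
    · left; subst h1; simp
    · by_cases h2 : i = j.succ
      · right; left; subst h2; simp
      · right; right
        exact ⟨fun h => h1 (Fin.ext h), fun h => h2 (Fin.ext h), Equiv.swap_apply_of_ne_of_ne h1 h2⟩
  rcases key i with ⟨rfl, e1⟩ | ⟨rfl, e1⟩ | ⟨h1, h1', e1⟩ <;>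
  rcases key k with ⟨rfl, e2⟩ | ⟨rfl, e2⟩ | ⟨h2, h2', e2⟩ <;>
  simp only [e1, e2, Fin.val_castSucc, Fin.val_succ, abs_eq_max_neg] <;> omega

/-- Equal nonnegative neighbours are consecutive in the list, the left one first. For negative
entries the order is reversed. -/
lemma corank_succ_of_nonneg {m : ℕ} (j : Fin m) (γ : Fin (m + 1) → ℤ)
    (h : γ j.castSucc = γ j.succ) (h0 : 0 ≤ γ j.castSucc) :
    corank γ j.castSucc = corank γ j.succ + 1 := by
  classical
  have e : (Finset.univ.filter fun i => After γ j.castSucc i) =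
      insert j.succ (Finset.univ.filter fun i => After γ j.succ i) := by
    ext i
    simp only [Finset.mem_filter, Finset.mem_univ, true_and, Finset.mem_insert, after_iff, ← h,
      Fin.val_castSucc, Fin.val_succ]
    by_cases h1 : i = j.succ
    · subst h1; simp only [true_or, iff_true, ← h, Fin.val_succ, lt_self_iff_false, true_and]; omega
    · have : (i : ℕ) ≠ j + 1 := fun h => h1 (Fin.ext h)
      simp only [h1, false_or]
      omega
  rw [corank, e, Finset.card_insert_of_notMem, corank]
  rw [Finset.mem_filter, not_and]
  exact fun _ => lt_irrefl _

lemma corank_succ_of_neg {m : ℕ} (j : Fin m) (γ : Fin (m + 1) → ℤ)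
    (h : γ j.castSucc = γ j.succ) (h0 : γ j.castSucc < 0) :
    corank γ j.succ = corank γ j.castSucc + 1 := by
  classical
  have e : (Finset.univ.filter fun i => After γ j.succ i) =
      insert j.castSucc (Finset.univ.filter fun i => After γ j.castSucc i) := by
    ext i
    simp only [Finset.mem_filter, Finset.mem_univ, true_and, Finset.mem_insert, after_iff, ← h,
      Fin.val_castSucc, Fin.val_succ]
    by_cases h1 : i = j.castSucc
    · subst h1; simp only [true_or, iff_true, h, Fin.val_castSucc, lt_self_iff_false, true_and]; omega
    · have : (i : ℕ) ≠ j := fun h => h1 (Fin.ext h)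
      simp only [h1, false_or]
      omega
  rw [corank, e, Finset.card_insert_of_notMem, corank]
  rw [Finset.mem_filter, not_and]
  exact fun _ => lt_irrefl _


/-! ### Existence of interpolation polynomials -/

/-- The enumeration `0, -1, 1, -2, 2, …` of the integers. -/
def stateInt (k : ℕ) : ℤ := if Even k then (k / 2 : ℕ) else -((k + 1) / 2 : ℕ)

lemma stateInt_zero : stateInt 0 = 0 := rfl

/-- Together with `exists_stateInt_eq_neg_sub_one`, this controls the two exponents produced by a
Newton factor: the reflections `a ↦ -a` and `a ↦ -1 - a` raise the index in the enumeration by at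
most one. -/
lemma exists_stateInt_eq_neg (k : ℕ) : ∃ l ≤ k + 1, stateInt l = -stateInt k := by
  rcases Nat.even_or_odd' k with ⟨a, rfl | rfl⟩
  · rcases a with _ | a
    · exact ⟨0, by omega, rfl⟩
    · refine ⟨2 * a + 1, by omega, ?_⟩
      rw [stateInt, stateInt, if_neg (by simp), if_pos (by simp)]
      omega
  · refine ⟨2 * a + 2, by omega, ?_⟩
    rw [stateInt, stateInt, if_neg (by simp : ¬ Even (2 * a + 1)),
      if_pos ⟨a + 1, by omega⟩]
    omega

lemma exists_stateInt_eq_neg_sub_one (k : ℕ) : ∃ l ≤ k + 1, stateInt l = -1 - stateInt k := by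
  rcases Nat.even_or_odd' k with ⟨a, rfl | rfl⟩
  · refine ⟨2 * a + 1, by omega, ?_⟩
    rw [stateInt, stateInt, if_neg (by simp), if_pos (by simp)]
    omega
  · refine ⟨2 * a, by omega, ?_⟩
    rw [stateInt, stateInt, if_neg (by simp : ¬ Even (2 * a + 1)), if_pos (by simp)]
    omega

/-- The point attached to the states `K i` of the coordinates, where `κ i k` is the position of
the state `k` of the coordinate `i` in the ranking of all states of all coordinates. -/
def statePoint {n : ℕ} (κ : Fin n → ℕ → ℕ) (c : Fin n → ℕ → ℂ) (t : ℂ) (K : Fin n → ℕ)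
    (i : Fin n) : ℂ :=
  (c i (K i) * t ^ (Finset.univ.filter fun j => κ j (K j) < κ i (K i)).card) ^ ((-1 : ℤ) ^ K i)

/-- The exponents belonging to the states `k i`, relative to the initial states `p i`. -/
def stateExp {n : ℕ} (p k : Fin n → ℕ) (i : Fin n) : ℤ := (-1) ^ p i * stateInt (k i)

lemma neg_one_pow_mul_self (k : ℕ) : ((-1 : ℤ) ^ k) * (-1) ^ k = 1 := by
  rw [← pow_add, ← two_mul, pow_mul]; simp

/-- The span of the monomials belonging to a set of states. -/
def stateSpan {n : ℕ} (p : Fin n → ℕ) (D : Finset (Fin n → ℕ)) : Submodule ℂ (LaurentPoly n) :=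
  Submodule.span ℂ ((fun k => mono (stateExp p k)) '' (D : Set (Fin n → ℕ)))

lemma mono_mem_stateSpan {n : ℕ} {p : Fin n → ℕ} {D : Finset (Fin n → ℕ)} {k : Fin n → ℕ}
    (hk : k ∈ D) {γ : Fin n → ℤ} (h : stateExp p k = γ) : mono γ ∈ stateSpan p D :=
  Submodule.subset_span ⟨k, hk, by rw [← h]⟩

/-- Advancing the initial state of `i` by one flips the sign in `stateExp`. Seen from the old state,
an exponent `a` of coordinate `i` becomes `-a` under the term `1` and `-1 - a` under the other term.
Both have index at most `k i + 1`, hence lie in the lower set `D`. -/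
lemma newton_factor_mul_mem {n : ℕ} (p : Fin n → ℕ) (D : Finset (Fin n → ℕ))
    (hD : IsLowerSet (D : Set (Fin n → ℕ))) (i : Fin n) (b : ℂ) {h : LaurentPoly n}
    {E : Finset (Fin n → ℕ)} (hE : ∀ k ∈ E, k + Pi.single i 1 ∈ D)
    (hh : h ∈ stateSpan (p + Pi.single i 1) E) :
    (1 - b • mono (Pi.single i (-(-1) ^ p i))) * h ∈ stateSpan p D := by
  have key : ∀ k ∈ E, ∀ l ≤ k i + 1, Function.update k i l ∈ D := by
    intro k hk l hl
    refine hD ?_ (hE k hk)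
    intro j
    by_cases hj : j = i
    · subst hj; simpa using hl
    · simp [hj]
  have key2 : ∀ (k : Fin n → ℕ) (l : ℕ) (z : ℤ), stateInt l = z - stateInt (k i) →
      stateExp p (Function.update k i l) =
        Pi.single i ((-1) ^ p i * z) + stateExp (p + Pi.single i 1) k := by
    intro k l z hl
    ext j
    by_cases hj : j = i
    · subst hj
      simp only [stateExp, Function.update_self, Pi.add_apply, Pi.single_eq_same, pow_succ, hl]
      ring
    · simp [stateExp, hj]
  induction hh using Submodule.span_induction with
  | mem h hh =>
    obtain ⟨k, hk, rfl⟩ := hh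
    obtain ⟨l, hl, el⟩ := exists_stateInt_eq_neg (k i)
    obtain ⟨l', hl', el'⟩ := exists_stateInt_eq_neg_sub_one (k i)
    have e1 := key2 k l 0 (by rw [el, zero_sub])
    have e2 := key2 k l' (-1) el'
    rw [mul_zero, Pi.single_zero, zero_add] at e1
    rw [mul_neg_one] at e2
    dsimp only
    rw [sub_mul, one_mul, smul_mul_assoc, ← mono_add]
    exact sub_mem (mono_mem_stateSpan (key k hk l hl) e1)
      (Submodule.smul_mem _ _ (mono_mem_stateSpan (key k hk l' hl') e2))
  | zero => simp
  | add f g _ _ hf hg => rw [mul_add]; exact add_mem hf hg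
  | smul c f _ hf => rw [mul_smul_comm]; exact Submodule.smul_mem _ _ hf

section

variable {n : ℕ} (κ : Fin n → ℕ → ℕ) (c : Fin n → ℕ → ℂ) (t : ℂ)

lemma norm_add_two_mul_lt (hc : ∀ i k, ‖c i (k + 2)‖ < ‖c i k‖) (i : Fin n) (k a : ℕ) :
    ‖c i (k + 2 * (a + 1))‖ < ‖c i k‖ := by
  induction a with
  | zero => exact hc i k
  | succ a ih => exact (hc i (k + 2 * (a + 1))).trans ih

lemma statePoint_ne_zero (hc0 : ∀ i k, c i k ≠ 0) (ht0 : t ≠ 0) (K : Fin n → ℕ) (i : Fin n) :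
    statePoint κ c t K i ≠ 0 :=
  zpow_ne_zero _ (mul_ne_zero (hc0 _ _) (pow_ne_zero _ ht0))

/-- Newton interpolation by induction on `T.card + D.card`. Here `p` holds the initial states, `D`
the permitted advances, and `T` the coordinates that may still move; the frozen ones rank below all
of `T`. -/
theorem exists_interp_state (hκ : ∀ i, StrictMono (κ i))
    (hinj : ∀ i j k l, κ i k = κ j l → i = j) (hc0 : ∀ i k, c i k ≠ 0)
    (hc1 : ∀ i k, ‖c i k‖ < 1) (hc2 : ∀ i k, ‖c i (k + 2)‖ < ‖c i k‖)
    (ht0 : t ≠ 0) (ht1 : ‖t‖ < 1) (N : ℕ) :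
    ∀ (T : Finset (Fin n)) (p : Fin n → ℕ) (D : Finset (Fin n → ℕ)), T.card + D.card ≤ N →
      IsLowerSet (D : Set (Fin n → ℕ)) → (∀ k ∈ D, ∀ i, i ∉ T → k i = 0) →
      (∀ i, i ∉ T → ∀ j ∈ T, κ i (p i) < κ j (p j)) → ∀ v : (Fin n → ℕ) → ℂ,
      ∃ f ∈ stateSpan p D, ∀ k ∈ D,
        evalHom (statePoint κ c t (p + k)) (statePoint_ne_zero κ c t hc0 ht0 _) f = v k := by
  induction N with
  | zero =>
    intro T p D hN _ _ _ v
    have : D = ∅ := Finset.card_eq_zero.mp (by omega)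
    subst this
    exact ⟨0, zero_mem _, by simp⟩
  | succ N ih =>
    intro T p D hN hD hDT hT v
    rcases D.eq_empty_or_nonempty with rfl | ⟨k₀, hk₀⟩
    · exact ⟨0, zero_mem _, by simp⟩
    have h0 : (0 : Fin n → ℕ) ∈ D := hD (fun i => Nat.zero_le _) hk₀
    rcases T.eq_empty_or_nonempty with rfl | hTne
    · refine ⟨v 0 • mono 0, Submodule.smul_mem _ _ (mono_mem_stateSpan h0 ?_), fun k hk => ?_⟩
      · ext i; simp [stateExp, stateInt_zero]
      · have : k = 0 := funext fun i => hDT k hk i (by simp)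
        rw [map_smul, mono_zero, map_one, this, smul_eq_mul, mul_one]
    obtain ⟨i, hi, hmin⟩ := T.exists_min_image (fun i => κ i (p i)) hTne
    have hlt : ∀ j ∈ T, j ≠ i → κ i (p i) < κ j (p j) := fun j hj hne =>
      lt_of_le_of_ne (hmin j hj) fun h => hne (hinj _ _ _ _ h).symm
    set r := (Finset.univ.filter fun j => j ∉ T).card with hr
    -- With `i` minimal in `T`, exactly the `r` frozen coordinates rank below its initial state. So
    -- `b` is its value, up to inversion, whenever `k i = 0`, whatever the others do.
    set b := c i (p i) * t ^ r with hb
    have hb0 : b ≠ 0 := mul_ne_zero (hc0 _ _) (pow_ne_zero _ ht0)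
    have htr : ∀ m, ‖t ^ m‖ ≤ 1 := fun m => by
      rw [norm_pow]; exact pow_le_one₀ (norm_nonneg _) ht1.le
    have hlt1 : ∀ k m, ‖c i k * t ^ m‖ < 1 := fun k m => by
      rw [norm_mul]
      exact (mul_le_of_le_one_right (norm_nonneg _) (htr m)).trans_lt (hc1 _ _)
    have heval : ∀ k : Fin n → ℕ, ∀ y, y = c i (p i + k i) *
        t ^ (Finset.univ.filter fun j => κ j (p j + k j) < κ i (p i + k i)).card →
        evalHom (statePoint κ c t (p + k)) (statePoint_ne_zero κ c t hc0 ht0 _)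
          (1 - b • mono (Pi.single i (-(-1) ^ p i))) = 1 - b * y ^ (-(-1 : ℤ) ^ k i) := by
      rintro k y rfl
      rw [map_sub, map_one, map_smul, evalHom_mono_single, smul_eq_mul, statePoint, ← zpow_mul]
      congr 3
      rw [Pi.add_apply, pow_add]
      linear_combination (-(-1 : ℤ) ^ k i) * neg_one_pow_mul_self (p i)
    have hzero : ∀ k ∈ D, k i = 0 →
        evalHom (statePoint κ c t (p + k)) (statePoint_ne_zero κ c t hc0 ht0 _)
          (1 - b • mono (Pi.single i (-(-1) ^ p i))) = 0 := by
      intro k hk hki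
      rw [heval k b, hki]
      · simp [hb0]
      · rw [hki, add_zero, hb, hr]
        congr 3
        ext j
        simp only [Finset.mem_filter, Finset.mem_univ, true_and]
        by_cases hj : j ∈ T
        · simp only [hj, not_true_eq_false, false_iff, not_lt]
          exact (hmin j hj).trans ((hκ j).monotone (Nat.le_add_right _ _))
        · simp only [hj, not_false_eq_true, true_iff, hDT k hk j hj, add_zero]
          exact hT j hj i hi
    have hnz : ∀ k ∈ D, k i ≠ 0 →
        evalHom (statePoint κ c t (p + k)) (statePoint_ne_zero κ c t hc0 ht0 _)
          (1 - b • mono (Pi.single i (-(-1) ^ p i))) ≠ 0 := by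
      intro k hk hki
      rw [heval k _ rfl]
      set r' := (Finset.univ.filter fun j => κ j (p j + k j) < κ i (p i + k i)).card with hr'
      have hrr : r ≤ r' := by
        refine Finset.card_le_card fun j hj => ?_
        simp only [Finset.mem_filter, Finset.mem_univ, true_and] at hj ⊢
        rw [hDT k hk j hj, add_zero]
        exact (hT j hj i hi).trans_le ((hκ i).monotone (Nat.le_add_right _ _))
      -- For even `k i` the factor is `1 - b / y`, and `|y| < |b|`, since two steps of the state
      -- shrink `c` and the rank does not drop. For odd `k i` it is `1 - b * y` with `|b|, |y| < 1`.
      rcases Nat.even_or_odd' (k i) with ⟨a, ha | ha⟩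
      · obtain ⟨a, rfl⟩ : ∃ a', a = a' + 1 := ⟨a - 1, by omega⟩
        have hy0 : c i (p i + k i) * t ^ r' ≠ 0 := mul_ne_zero (hc0 _ _) (pow_ne_zero _ ht0)
        have e : (-1 : ℤ) ^ k i = 1 := by rw [ha, pow_mul]; simp
        rw [e, zpow_neg_one, sub_ne_zero]
        intro h
        have hby : b = c i (p i + k i) * t ^ r' := by
          rw [← div_eq_mul_inv] at h
          exact ((div_eq_one_iff_eq hy0).mp h.symm)
        have h1 : ‖c i (p i + k i) * t ^ r'‖ < ‖b‖ := by
          rw [hb, norm_mul, norm_mul, norm_pow, norm_pow]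
          refine mul_lt_mul (ha ▸ norm_add_two_mul_lt c hc2 i (p i) a)
            (pow_le_pow_of_le_one (norm_nonneg _) ht1.le hrr) (by positivity) (norm_nonneg _)
        rw [← hby] at h1
        exact lt_irrefl _ h1
      · have e : (-1 : ℤ) ^ k i = -1 := by rw [ha, pow_succ, pow_mul]; simp
        rw [e, neg_neg, zpow_one, sub_ne_zero]
        intro h
        have h1 : ‖b * (c i (p i + k i) * t ^ r')‖ < 1 := by
          rw [norm_mul]
          exact mul_lt_one_of_nonneg_of_lt_one_left (norm_nonneg _) (hlt1 _ _) (hlt1 _ _).le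
        rw [← h, norm_one] at h1
        exact lt_irrefl _ h1
    -- On the slice `k i = 0` coordinate `i` is frozen; `g` takes the prescribed values there.
    obtain ⟨g, hg, hgv⟩ := ih (T.erase i) p (D.filter fun k => k i = 0)
      (by
        have h1 := Finset.card_filter_le D fun k => k i = 0
        have h2 := Finset.card_erase_add_one hi
        omega)
      (by
        intro k l hl hk
        simp only [Finset.coe_filter, Set.mem_ofPred_eq] at hk ⊢
        have := hl i
        exact ⟨hD hl hk.1, Nat.le_zero.mp (this.trans_eq hk.2)⟩)
      (by
        intro k hk j hj
        rw [Finset.mem_filter] at hk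
        by_cases hji : j = i
        · rw [hji, hk.2]
        · exact hDT k hk.1 j fun h => hj (Finset.mem_erase.mpr ⟨hji, h⟩))
      (by
        intro j hj l hl
        obtain ⟨hli, hl⟩ := Finset.mem_erase.mp hl
        by_cases hji : j = i
        · rw [hji]; exact hlt l hl hli
        · exact hT j (fun h => hj (Finset.mem_erase.mpr ⟨hji, h⟩)) l hl) v
    have hsub : ∀ k : Fin n → ℕ, k i ≠ 0 → k - Pi.single i 1 + Pi.single i 1 = k := by
      intro k hk
      ext j
      by_cases hj : j = i
      · subst hj; simp; omega
      · simp [hj]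
    set E := (D.filter fun k => k i ≠ 0).image fun k => k - Pi.single i 1 with hE
    have hED : ∀ k, k ∈ E ↔ k + Pi.single i 1 ∈ D := by
      intro k
      rw [hE, Finset.mem_image]
      constructor
      · rintro ⟨l, hl, rfl⟩
        rw [Finset.mem_filter] at hl
        rw [hsub l hl.2]
        exact hl.1
      · intro h
        refine ⟨k + Pi.single i 1, Finset.mem_filter.mpr ⟨h, by simp⟩, by simp⟩
    -- On the rest, `i` has advanced at least once. Its first step is absorbed into `p`, and `h`
    -- interpolates the remaining error divided by the Newton factor. The set shrinks because `0 ∈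
    -- D` is lost.
    obtain ⟨h, hh, hhv⟩ := ih T (p + Pi.single i 1) E
      (by
        have h1 : E.card < D.card := Finset.card_image_le.trans_lt
          (Finset.card_lt_card (Finset.filter_ssubset.mpr ⟨0, h0, by simp⟩))
        omega)
      (by
        intro k l hl hk
        rw [Finset.mem_coe, hED] at hk ⊢
        exact hD (add_le_add_left hl _) hk)
      (by
        intro k hk j hj
        have := hDT _ ((hED k).mp hk) j hj
        rw [Pi.add_apply] at this
        omega)
      (by
        intro j hj l hl
        have hji : j ≠ i := fun h => hj (h ▸ hi)
        have e : (p + Pi.single i 1 : Fin n → ℕ) j = p j := by simp [hji]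
        rw [e]
        exact (hT j hj l hl).trans_le ((hκ l).monotone (Nat.le_add_right _ _)))
      (fun k => (v (k + Pi.single i 1) - evalHom (statePoint κ c t (p + (k + Pi.single i 1)))
          (statePoint_ne_zero κ c t hc0 ht0 _) g) /
        evalHom (statePoint κ c t (p + (k + Pi.single i 1))) (statePoint_ne_zero κ c t hc0 ht0 _)
          (1 - b • mono (Pi.single i (-(-1) ^ p i))))
    refine ⟨g + (1 - b • mono (Pi.single i (-(-1) ^ p i))) * h, add_mem ?_
      (newton_factor_mul_mem p D hD i b (fun k hk => (hED k).mp hk) hh), fun k hk => ?_⟩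
    · exact Submodule.span_mono (Set.image_mono (Finset.coe_subset.mpr
        (Finset.filter_subset _ _))) hg
    rw [map_add, map_mul]
    by_cases hki : k i = 0
    · rw [hzero k hk hki, zero_mul, add_zero]
      exact hgv k (Finset.mem_filter.mpr ⟨hk, hki⟩)
    · have hk' := hsub k hki
      have h1 := hhv (k - Pi.single i 1) ((hED _).mpr (hk'.symm ▸ hk))
      have e : p + Pi.single i 1 + (k - Pi.single i 1) = p + k := by
        rw [add_assoc, add_comm (Pi.single i 1), hk']
      simp only [e, hk'] at h1
      rw [h1, mul_div_cancel₀ _ (hnz k hk hki)]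
      ring

end


/-! ### The interpolation problem -/

/-- The index of an integer in the enumeration `stateInt`. -/
def stateOf (a : ℤ) : ℕ := if 0 ≤ a then 2 * a.natAbs else 2 * a.natAbs - 1

lemma even_stateOf (a : ℤ) : Even (stateOf a) ↔ 0 ≤ a := by
  rw [stateOf, Nat.even_iff]
  split_ifs <;> omega

lemma stateInt_stateOf (a : ℤ) : stateInt (stateOf a) = a := by
  have h := even_stateOf a
  rw [stateInt]
  unfold stateOf at *
  split_ifs at * <;> simp_all <;> omega

lemma neg_one_pow_stateOf (a : ℤ) : (-1 : ℤ) ^ stateOf a = sgn a := by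
  rw [neg_one_pow_eq_ite, sgn]
  simp only [even_stateOf]

lemma natAbs_stateInt (k : ℕ) : (stateInt k).natAbs = (k + 1) / 2 := by
  rw [stateInt]
  split_ifs with h
  · rw [Nat.even_iff] at h; omega
  · omega

/-- The position of the state `k` of the coordinate `i` in the ranking of all states. -/
def stateKey {n : ℕ} (i : Fin n) (k : ℕ) : ℕ := k * n + if Even k then n - 1 - i else i

/-- The second summand is less than `n`, so the key compares lexicographically. -/
lemma stateKey_lt_iff {n : ℕ} (i j : Fin n) (k l : ℕ) :
    stateKey i k < stateKey j l ↔ k < l ∨ k = l ∧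
      (if Even k then n - 1 - i else (i : ℕ)) < (if Even l then n - 1 - j else (j : ℕ)) := by
  have hi : (if Even k then n - 1 - i else (i : ℕ)) < n := by have := i.isLt; split_ifs <;> omega
  have hj : (if Even l then n - 1 - j else (j : ℕ)) < n := by have := j.isLt; split_ifs <;> omega
  unfold stateKey
  rcases lt_trichotomy k l with h | rfl | h
  · have := Nat.mul_le_mul_right n (Nat.succ_le_of_lt h)
    rw [Nat.succ_mul] at this
    simp only [h, true_or, iff_true]
    omega
  · simp
  · have := Nat.mul_le_mul_right n (Nat.succ_le_of_lt h)
    rw [Nat.succ_mul] at this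
    simp only [h.not_gt, h.ne', false_and, or_false, iff_false]
    omega

lemma stateKey_strictMono {n : ℕ} (i : Fin n) : StrictMono (stateKey i) :=
  fun _ _ h => (stateKey_lt_iff _ _ _ _).mpr (Or.inl h)

lemma eq_of_stateKey_eq {n : ℕ} (i j : Fin n) (k l : ℕ) (h : stateKey i k = stateKey j l) :
    i = j := by
  have h1 := (stateKey_lt_iff i j k l).not.mp h.not_lt
  have h2 := (stateKey_lt_iff j i l k).not.mp h.not_gt
  have hkl : k = l := by omega
  subst hkl
  have := i.isLt
  have := j.isLt
  apply Fin.ext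
  split_ifs at h1 h2 <;> omega

/-- The ranking of all states is the listing order read backwards. This identifies the exponents of
`t` in `statePoint` with coranks. -/
lemma after_iff_stateKey {n : ℕ} (γ : Fin n → ℤ) (i j : Fin n) :
    After γ i j ↔ stateKey j (stateOf (γ j)) < stateKey i (stateOf (γ i)) := by
  rw [after_iff, stateKey_lt_iff]
  simp only [even_stateOf]
  simp only [abs_eq_max_neg, stateOf]
  have := i.isLt
  have := j.isLt
  split_ifs <;> omega

/-- Since `a = sgn a * |a|`, the power of `q` moves inside the outer exponent. Every coordinate is
thus a number of norm below one (given the bounds on `q`, `s`, `t`), or the inverse of one. -/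
lemma interpPoint_apply {n : ℕ} (q s t : ℂ) (γ : Fin n → ℤ) (i : Fin n) :
    interpPoint q (principalPoint s t) γ i =
      (q ^ (γ i).natAbs * s * t ^ corank γ i) ^ sgn (γ i) := by
  rw [interpPoint, principalPoint, ← corank_eq, mul_assoc, mul_zpow (q ^ _)]
  congr 1
  rw [← zpow_natCast q, ← zpow_mul]
  congr 1
  rw [sgn]
  split_ifs <;> omega

/-- The parameters of the states in the principal specialization. -/
def stateParam {n : ℕ} (q s : ℂ) (_ : Fin n) (k : ℕ) : ℂ := q ^ (stateInt k).natAbs * s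

lemma statePoint_eq_interpPoint {n : ℕ} (q s t : ℂ) (γ : Fin n → ℤ) :
    statePoint stateKey (stateParam q s) t (fun i => stateOf (γ i)) =
      interpPoint q (principalPoint s t) γ := by
  classical
  ext i
  rw [interpPoint_apply, statePoint, stateParam, stateInt_stateOf, neg_one_pow_stateOf, corank]
  simp only [after_iff_stateKey]

lemma interpPoint_ne_zero {n : ℕ} {q s t : ℂ} (hq0 : q ≠ 0) (hs0 : s ≠ 0) (ht0 : t ≠ 0)
    (γ : Fin n → ℤ) (i : Fin n) : interpPoint q (principalPoint s t) γ i ≠ 0 := by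
  rw [interpPoint_apply]
  exact zpow_ne_zero _ (mul_ne_zero (mul_ne_zero (pow_ne_zero _ hq0) hs0) (pow_ne_zero _ ht0))

theorem exists_interp {n : ℕ} {q s t : ℂ} (hq0 : q ≠ 0) (hq1 : ‖q‖ < 1) (hs0 : s ≠ 0)
    (hs1 : ‖s‖ < 1) (ht0 : t ≠ 0) (ht1 : ‖t‖ < 1) (d : ℕ) (v : (Fin n → ℤ) → ℂ) :
    ∃ f ∈ degSubmodule n d, ∀ γ, weight γ ≤ d →
      evalAt (interpPoint q (principalPoint s t) γ) f = v γ := by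
  have hfin : {k : Fin n → ℕ | weight (fun i => stateInt (k i)) ≤ d}.Finite := by
    refine (Set.finite_Icc 0 (fun _ : Fin n => 2 * d)).subset fun k hk => ⟨fun i => Nat.zero_le _,
      fun i => ?_⟩
    have h1 : (stateInt (k i)).natAbs ≤ weight fun i => stateInt (k i) :=
      Finset.single_le_sum (f := fun i => (stateInt (k i)).natAbs) (fun _ _ => Nat.zero_le _)
        (Finset.mem_univ i)
    have h2 : weight (fun i => stateInt (k i)) ≤ d := hk
    rw [natAbs_stateInt] at h1
    show k i ≤ 2 * d
    omega
  have hc0 : ∀ (i : Fin n) k, stateParam q s i k ≠ 0 := fun i k =>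
    mul_ne_zero (pow_ne_zero _ hq0) hs0
  obtain ⟨f, hf, hfv⟩ := exists_interp_state stateKey (stateParam q s) t
    stateKey_strictMono eq_of_stateKey_eq hc0
    (fun i k => by
      rw [stateParam, norm_mul, norm_pow]
      exact mul_lt_one_of_nonneg_of_lt_one_right (pow_le_one₀ (norm_nonneg _) hq1.le)
        (norm_nonneg _) hs1)
    (fun i k => by
      rw [stateParam, stateParam, norm_mul, norm_mul, norm_pow, norm_pow, natAbs_stateInt,
        natAbs_stateInt]
      refine mul_lt_mul_of_pos_right ?_ (norm_pos_iff.mpr hs0)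
      exact pow_lt_pow_right_of_lt_one₀ (norm_pos_iff.mpr hq0) hq1 (by omega))
    ht0 ht1 _ Finset.univ 0 hfin.toFinset le_rfl
    -- The absolute value of the state `k` is `(k + 1) / 2`, which is monotone in `k`, so a weight
    -- ball is a lower set of states.
    (by
      intro k l hl hk
      rw [Set.Finite.coe_toFinset] at hk ⊢
      refine le_trans (b := weight fun i => stateInt (k i)) (Finset.sum_le_sum fun i _ => ?_) hk
      have : l i ≤ k i := hl i
      rw [natAbs_stateInt, natAbs_stateInt]
      omega)
    (fun _ _ i hi => absurd (Finset.mem_univ i) hi) (fun i hi => absurd (Finset.mem_univ i) hi)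
    (fun k => v fun i => stateInt (k i))
  refine ⟨f, ?_, fun γ hγ => ?_⟩
  · refine (Submodule.span_le.mpr ?_) hf
    rintro _ ⟨k, hk, rfl⟩
    refine mono_mem_degSubmodule ?_
    rw [Finset.mem_coe, Set.Finite.mem_toFinset] at hk
    have e : stateExp 0 k = fun i => stateInt (k i) := by ext i; simp [stateExp]
    rw [e]
    exact hk
  · have h := hfv (fun i => stateOf (γ i)) (by simpa [stateInt_stateOf] using hγ)
    rw [evalHom_apply, zero_add, statePoint_eq_interpPoint] at h
    simpa only [stateInt_stateOf] using h

lemma finite_weight_le (n d : ℕ) : {γ : Fin n → ℤ | weight γ ≤ d}.Finite := by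
  refine (Set.finite_Icc (fun _ : Fin n => -(d : ℤ)) (fun _ => (d : ℤ))).subset fun γ hγ => ?_
  have h1 : ∀ i, (γ i).natAbs ≤ d := fun i =>
    (Finset.single_le_sum (f := fun i => (γ i).natAbs) (fun _ _ => Nat.zero_le _)
      (Finset.mem_univ i)).trans hγ
  constructor <;> intro i <;> have := h1 i <;> dsimp only <;> omega

/-- Coefficients and values are indexed by the same finite set, so evaluation is an endomorphism of
a finite-dimensional space. It is surjective by `exists_interp`, hence injective. -/
theorem eq_zero_of_evalAt_eq_zero {n : ℕ} {q s t : ℂ} (hq0 : q ≠ 0) (hq1 : ‖q‖ < 1)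
    (hs0 : s ≠ 0) (hs1 : ‖s‖ < 1) (ht0 : t ≠ 0) (ht1 : ‖t‖ < 1) {d : ℕ} {f : LaurentPoly n}
    (hf : f ∈ degSubmodule n d)
    (h : ∀ γ, weight γ ≤ d → evalAt (interpPoint q (principalPoint s t) γ) f = 0) : f = 0 := by
  have : Finite {γ : Fin n → ℤ // weight γ ≤ d} := finite_weight_le n d
  have := Fintype.ofFinite {γ : Fin n → ℤ // weight γ ≤ d}
  let Φ : ({γ : Fin n → ℤ // weight γ ≤ d} → ℂ) →ₗ[ℂ] LaurentPoly n :=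
    Fintype.linearCombination ℂ fun γ => mono γ.1
  have hΦ : LinearMap.range Φ = degSubmodule n d := by
    rw [Fintype.range_linearCombination, degSubmodule]
    congr 1
    ext f
    simp
  let ev : LaurentPoly n →ₗ[ℂ] ({γ : Fin n → ℤ // weight γ ≤ d} → ℂ) :=
    LinearMap.pi fun γ => (evalHom (interpPoint q (principalPoint s t) γ.1)
      (interpPoint_ne_zero hq0 hs0 ht0 _)).toLinearMap
  have hev : ∀ g γ, ev g γ = evalAt (interpPoint q (principalPoint s t) γ.1) g :=
    fun g γ =>
    evalHom_apply _ (interpPoint_ne_zero hq0 hs0 ht0 _) g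
  have hsurj : Function.Surjective (ev ∘ₗ Φ) := by
    intro v
    obtain ⟨g, hg, hgv⟩ := exists_interp hq0 hq1 hs0 hs1 ht0 ht1 d
      (fun γ => if h : weight γ ≤ d then v ⟨γ, h⟩ else 0)
    rw [← hΦ] at hg
    obtain ⟨w, rfl⟩ := hg
    refine ⟨w, ?_⟩
    ext γ
    rw [LinearMap.comp_apply, hev, hgv γ.1 γ.2, dif_pos γ.2]
  have hinj := LinearMap.injective_iff_surjective.mpr hsurj
  rw [← hΦ] at hf
  obtain ⟨w, rfl⟩ := hf
  have hw : w = 0 := hinj (by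
    rw [map_zero]
    ext γ
    rw [LinearMap.comp_apply, hev]
    exact h γ.1 γ.2)
  rw [hw, map_zero]

theorem isInterp_G {n : ℕ} {q s t : ℂ} (hq0 : q ≠ 0) (hq1 : ‖q‖ < 1)
    (hs0 : s ≠ 0) (hs1 : ‖s‖ < 1) (ht0 : t ≠ 0) (ht1 : ‖t‖ < 1) (α : Fin n → ℤ) :
    IsInterp q (principalPoint s t) α (G q s t α) := by
  classical
  apply Classical.epsilon_spec (p := IsInterp q (principalPoint s t) α)
  obtain ⟨f, hf, hfv⟩ := exists_interp hq0 hq1 hs0 hs1 ht0 ht1 (weight α) (Pi.single α 1)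
  refine ⟨f, mem_degSubmodule.mp hf, ?_, fun β hβ hne => ?_⟩
  · rw [hfv α le_rfl, Pi.single_eq_same]
  · rw [hfv β hβ, Pi.single_eq_of_ne hne]

lemma evalAt_sub {n : ℕ} {x : Fin n → ℂ} (hx : ∀ i, x i ≠ 0) (f g : LaurentPoly n) :
    evalAt x (f - g) = evalAt x f - evalAt x g := by
  simp only [← evalHom_apply x hx, map_sub]

theorem eq_of_evalAt_eq {n : ℕ} {q s t : ℂ} (hq0 : q ≠ 0) (hq1 : ‖q‖ < 1)
    (hs0 : s ≠ 0) (hs1 : ‖s‖ < 1) (ht0 : t ≠ 0) (ht1 : ‖t‖ < 1) {d : ℕ} {f g : LaurentPoly n}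
    (hf : f ∈ degSubmodule n d) (hg : g ∈ degSubmodule n d)
    (h : ∀ γ, weight γ ≤ d → evalAt (interpPoint q (principalPoint s t) γ) f =
      evalAt (interpPoint q (principalPoint s t) γ) g) : f = g := by
  rw [← sub_eq_zero]
  refine eq_zero_of_evalAt_eq_zero hq0 hq1 hs0 hs1 ht0 ht1 (sub_mem hf hg) fun γ hγ => ?_
  rw [evalAt_sub (interpPoint_ne_zero hq0 hs0 ht0 γ), h γ hγ, sub_self]


/-! ### The operators preserve the degree -/

lemma weight_simpleRefl {m : ℕ} (j : Fin m) (γ : Fin (m + 1) → ℤ) :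
    weight (simpleRefl j γ) = weight γ :=
  Equiv.sum_comp (Equiv.swap j.castSucc j.succ) fun i => (γ i).natAbs

lemma signRefl_natAbs {n : ℕ} (i k : Fin n) (γ : Fin n → ℤ) :
    (signRefl i γ k).natAbs = (γ k).natAbs := by
  by_cases h : k = i
  · subst h; rw [signRefl_apply_same, Int.natAbs_neg]
  · rw [signRefl_apply_of_ne h]

lemma weight_lastRefl {m : ℕ} (γ : Fin (m + 1) → ℤ) : weight (lastRefl m γ) = weight γ :=
  Finset.sum_congr rfl fun _ _ => signRefl_natAbs _ _ _

lemma simpleRefl_simpleRefl {m : ℕ} (j : Fin m) (γ : Fin (m + 1) → ℤ) :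
    simpleRefl j (simpleRefl j γ) = γ := by
  ext i; simp [simpleRefl_apply]

lemma lastRefl_lastRefl {m : ℕ} (γ : Fin (m + 1) → ℤ) : lastRefl m (lastRefl m γ) = γ := by
  ext i
  by_cases h : i = Fin.last m
  · subst h; simp [lastRefl, signRefl_apply_same]
  · simp [lastRefl, signRefl_apply_of_ne h]

lemma weight_le_of_pair {n : ℕ} {γ δ : Fin n → ℤ} {a b : Fin n} (hab : a ≠ b)
    (h : ∀ i, i ≠ a → i ≠ b → δ i = γ i)
    (hle : (δ a).natAbs + (δ b).natAbs ≤ (γ a).natAbs + (γ b).natAbs) : weight δ ≤ weight γ := by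
  have key : ∀ ε : Fin n → ℤ, weight ε = ((ε a).natAbs + (ε b).natAbs) +
      ∑ i ∈ (Finset.univ.erase a).erase b, (ε i).natAbs := by
    intro ε
    rw [weight, ← Finset.add_sum_erase _ _ (Finset.mem_univ a),
      ← Finset.add_sum_erase _ _ (Finset.mem_erase.mpr ⟨hab.symm, Finset.mem_univ b⟩), add_assoc]
  rw [key, key]
  refine add_le_add hle (Finset.sum_le_sum fun i hi => ?_)
  simp only [Finset.mem_erase, Finset.mem_univ, and_true] at hi
  rw [h i hi.2 hi.1]

lemma dividedDiff_mono_of_involutive {n : ℕ} (w : (Fin n → ℤ) →+ (Fin n → ℤ)) (b : LaurentPoly n)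
    (hb : b ≠ 0) (h : ∀ f, b ∣ act w f - f) (γ : Fin n → ℤ) (hw : w (w γ) = γ) :
    dividedDiff w b hb h (mono (w γ)) = -dividedDiff w b hb h (mono γ) := by
  apply mul_left_cancel₀ hb
  rw [mul_neg, mul_dividedDiff, mul_dividedDiff, act_mono, act_mono, hw, neg_sub]

/-- The geometric sum for a string of exponents from `δ 0` to its reflection: each step is divisible
by `b`, and the differences telescope. -/
lemma dividedDiff_mono_eq_sum {n : ℕ} (w : (Fin n → ℤ) →+ (Fin n → ℤ)) (b : LaurentPoly n)
    (hb : b ≠ 0) (h : ∀ f, b ∣ act w f - f) (δ : ℕ → Fin n → ℤ) (u : LaurentPoly n) (k : ℕ)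
    (hδ : ∀ i, mono (δ (i + 1)) - mono (δ i) = b * (-(mono (δ i) * u))) (hk : w (δ 0) = δ k) :
    dividedDiff w b hb h (mono (δ 0)) = -∑ i ∈ Finset.range k, mono (δ i) * u := by
  apply mul_left_cancel₀ hb
  rw [mul_dividedDiff, act_mono, hk, ← Finset.sum_range_sub (fun i => mono (δ i)),
    ← Finset.sum_neg_distrib, Finset.mul_sum]
  exact Finset.sum_congr rfl fun i _ => hδ i

lemma X_mul_Xinv {n : ℕ} (i : Fin n) : (X i * Xinv i : LaurentPoly n) = 1 := by
  rw [X, Xinv, ← mono_add, ← Pi.single_add, add_neg_cancel, Pi.single_zero, mono_zero]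

lemma dividedDiff_simpleRefl_mem {m d : ℕ} (j : Fin m) (γ : Fin (m + 1) → ℤ) (hγ : weight γ ≤ d) :
    X j.castSucc * dividedDiff (simpleRefl j) (X j.castSucc - X j.succ) (X_sub_X_ne_zero j)
        (dvd_simpleRefl j) (mono γ) ∈ degSubmodule (m + 1) d ∧
      X j.succ * dividedDiff (simpleRefl j) (X j.castSucc - X j.succ) (X_sub_X_ne_zero j)
        (dvd_simpleRefl j) (mono γ) ∈ degSubmodule (m + 1) d := by
  -- The divided difference is antisymmetric under the reflection.
  wlog hle : γ j.succ ≤ γ j.castSucc generalizing γ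
  · have h := this (simpleRefl j γ) (by rwa [weight_simpleRefl])
      (by rw [simpleRefl_castSucc, simpleRefl_succ]; omega)
    rw [dividedDiff_mono_of_involutive _ _ _ _ _ (simpleRefl_simpleRefl j γ), mul_neg, mul_neg,
      neg_mem_iff, neg_mem_iff] at h
    exact h
  have hne : j.castSucc ≠ j.succ := (Fin.castSucc_lt_succ).ne
  obtain ⟨k, hk⟩ := Int.le.dest hle
  let δ : ℕ → Fin (m + 1) → ℤ := fun i =>
    γ + (i : ℤ) • (Pi.single j.succ 1 - Pi.single j.castSucc 1)
  have hδ0 : δ 0 = γ := by simp [δ]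
  have hδs : ∀ i, mono (δ (i + 1)) = mono (δ i) * (X j.succ * Xinv j.castSucc) := by
    intro i
    rw [X, Xinv, ← mono_add, ← mono_add]
    congr 1
    simp only [δ, Pi.single_neg]
    push_cast
    rw [add_smul, one_smul]
    abel
  have hδ : ∀ i, mono (δ (i + 1)) - mono (δ i) =
      (X j.castSucc - X j.succ) * (-(mono (δ i) * Xinv j.castSucc)) := by
    intro i
    rw [hδs]
    linear_combination mono (δ i) * X_mul_Xinv (j.castSucc)
  have hwk : simpleRefl j (δ 0) = δ k := by
    ext i
    rw [hδ0, simpleRefl_apply]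
    by_cases h1 : i = j.castSucc
    · subst h1
      simp [δ, hne]
      omega
    · by_cases h2 : i = j.succ
      · subst h2
        simp [δ, hne.symm]
        omega
      · rw [Equiv.swap_apply_of_ne_of_ne h1 h2]
        simp [δ, h1, h2]
  -- The string runs between `γ` and its reflection, so convexity of the absolute value bounds the
  -- weights.
  have hmem : ∀ i ≤ k, mono (δ i) ∈ degSubmodule (m + 1) d := by
    intro i hi
    refine mono_mem_degSubmodule ((weight_le_of_pair hne (fun l h1 h2 => ?_) ?_).trans hγ)
    · simp [δ, h1, h2]
    · simp [δ, hne, hne.symm]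
      omega
  have hdd := dividedDiff_mono_eq_sum (simpleRefl j) (X j.castSucc - X j.succ) (X_sub_X_ne_zero j)
    (dvd_simpleRefl j) δ (Xinv j.castSucc) k hδ hwk
  rw [hδ0] at hdd
  rw [hdd, mul_neg, mul_neg, neg_mem_iff, neg_mem_iff, Finset.mul_sum, Finset.mul_sum]
  constructor <;> refine sum_mem fun i hi => ?_
  · have e : X j.castSucc * (mono (δ i) * Xinv j.castSucc) = mono (δ i) := by
      linear_combination mono (δ i) * X_mul_Xinv (j.castSucc)
    rw [e]
    exact hmem i (Finset.mem_range.mp hi).le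
  · have e : X j.succ * (mono (δ i) * Xinv j.castSucc) = mono (δ (i + 1)) := by
      rw [hδs]; ring
    rw [e]
    exact hmem (i + 1) (Finset.mem_range.mp hi)

lemma dividedDiff_lastRefl_mem {m d : ℕ} (γ : Fin (m + 1) → ℤ) (hγ : weight γ ≤ d) (l : ℕ)
    (hl : l ≤ 2) :
    Xinv (Fin.last m) ^ l * dividedDiff (lastRefl m) (1 - Xinv (Fin.last m) ^ 2)
      (one_sub_Xinv_sq_ne_zero (Fin.last m)) dvd_lastRefl (mono γ) ∈ degSubmodule (m + 1) d := by
  wlog hle : 0 ≤ γ (Fin.last m) generalizing γ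
  · have h := this (lastRefl m γ) (by rwa [weight_lastRefl])
      (by rw [lastRefl, signRefl_apply_same]; omega)
    rw [dividedDiff_mono_of_involutive _ _ _ _ _ (lastRefl_lastRefl γ), mul_neg,
      neg_mem_iff] at h
    exact h
  obtain ⟨k, hk⟩ := Int.eq_ofNat_of_zero_le hle
  let δ : ℕ → Fin (m + 1) → ℤ := fun i => γ + (i : ℤ) • Pi.single (Fin.last m) (-1)
  have hδ0 : δ 0 = γ := by simp [δ]
  have hδl : ∀ l i, mono (δ (i + l)) = Xinv (Fin.last m) ^ l * mono (δ i) := by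
    intro l i
    induction l with
    | zero => simp
    | succ l ih =>
      rw [pow_succ', mul_assoc, ← ih, Xinv, ← mono_add]
      congr 1
      simp only [δ]
      push_cast
      rw [← add_assoc, add_smul _ (1 : ℤ), one_smul]
      abel
  have hwk : lastRefl m (δ (2 * 0)) = δ (2 * k) := by
    ext i
    rw [mul_zero, hδ0, lastRefl]
    by_cases h1 : i = Fin.last m
    · subst h1
      rw [signRefl_apply_same]
      simp [δ]
      omega
    · rw [signRefl_apply_of_ne h1]
      simp [δ, h1]
  have hmem : ∀ i ≤ 2 * k, mono (δ i) ∈ degSubmodule (m + 1) d := by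
    intro i hi
    refine mono_mem_degSubmodule (le_trans (Finset.sum_le_sum fun a _ => ?_) hγ)
    by_cases h1 : a = Fin.last m
    · subst h1
      simp [δ]
      omega
    · simp [δ, h1]
  -- The denominator has degree two in the inverse variable, so only every second exponent occurs.
  -- The powers `l ≤ 2` then keep `2 * i + l` within `2 * k`.
  have hdd := dividedDiff_mono_eq_sum (lastRefl m) (1 - Xinv (Fin.last m) ^ 2)
    (one_sub_Xinv_sq_ne_zero (Fin.last m)) dvd_lastRefl (fun i => δ (2 * i)) 1 k
    (fun i => by
      rw [mul_add, mul_one, hδl]; ring) hwk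
  simp only [mul_zero, hδ0, mul_one] at hdd
  rw [hdd, mul_neg, neg_mem_iff, Finset.mul_sum]
  refine sum_mem fun i hi => ?_
  rw [← hδl]
  have := Finset.mem_range.mp hi
  exact hmem _ (by omega)

lemma demazureLusztig_mem {m d : ℕ} (t : ℂ) (j : Fin m) {f : LaurentPoly (m + 1)}
    (hf : f ∈ degSubmodule (m + 1) d) : demazureLusztig t j f ∈ degSubmodule (m + 1) d := by
  refine map_mem_degSubmodule _ (fun γ hγ => ?_) hf
  obtain ⟨h1, h2⟩ := dividedDiff_simpleRefl_mem j γ hγ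
  simp only [demazureLusztig, LinearMap.add_apply, LinearMap.smul_apply, LinearMap.id_apply,
    LinearMap.comp_apply, LinearMap.mulLeft_apply, sub_mul, smul_mul_assoc]
  exact add_mem (Submodule.smul_mem _ _ (mono_mem_degSubmodule hγ))
    (sub_mem h1 (Submodule.smul_mem _ _ h2))

lemma demazureLusztigLast_mem {m d : ℕ} (s : ℂ) {f : LaurentPoly (m + 1)}
    (hf : f ∈ degSubmodule (m + 1) d) : demazureLusztigLast m s f ∈ degSubmodule (m + 1) d := by
  refine map_mem_degSubmodule _ (fun γ hγ => ?_) hf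
  have h := dividedDiff_lastRefl_mem γ hγ
  simp only [demazureLusztigLast, LinearMap.add_apply, LinearMap.neg_apply, LinearMap.id_apply,
    LinearMap.comp_apply, LinearMap.mulLeft_apply]
  set g := dividedDiff (lastRefl m) (1 - Xinv (Fin.last m) ^ 2)
      (one_sub_Xinv_sq_ne_zero (Fin.last m)) dvd_lastRefl (mono γ)
  have e : (1 - s • Xinv (Fin.last m)) * (1 - s⁻¹ • Xinv (Fin.last m)) * g =
      Xinv (Fin.last m) ^ 0 * g - (s + s⁻¹) • (Xinv (Fin.last m) ^ 1 * g) +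
        (s * s⁻¹) • (Xinv (Fin.last m) ^ 2 * g) := by
    simp only [Algebra.smul_def, map_add, map_mul]
    ring
  rw [e]
  exact add_mem (neg_mem (mono_mem_degSubmodule hγ)) (add_mem (sub_mem (h 0 (by omega))
    (Submodule.smul_mem _ _ (h 1 (by omega)))) (Submodule.smul_mem _ _ (h 2 le_rfl)))

/-! ### Values of the operators -/

lemma evalHom_act_simpleRefl {m : ℕ} (j : Fin m) (x : Fin (m + 1) → ℂ) (hx : ∀ i, x i ≠ 0)
    (f : LaurentPoly (m + 1)) :
    evalHom x hx (act (simpleRefl j) f) =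
      evalHom (fun i => x (Equiv.swap j.castSucc j.succ i)) (fun _ => hx _) f := by
  refine evalHom_subst _ x hx _ _ (fun γ => ?_) f
  rw [← Equiv.prod_comp (Equiv.swap j.castSucc j.succ)]
  simp [simpleRefl_apply]

lemma evalHom_act_lastRefl {m : ℕ} (x : Fin (m + 1) → ℂ) (hx : ∀ i, x i ≠ 0)
    (y : Fin (m + 1) → ℂ) (hy : ∀ i, y i ≠ 0) (h : y (Fin.last m) = (x (Fin.last m))⁻¹)
    (h' : ∀ i, i ≠ Fin.last m → y i = x i) (f : LaurentPoly (m + 1)) :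
    evalHom x hx (act (lastRefl m) f) = evalHom y hy f := by
  refine evalHom_subst _ x hx _ _ (fun γ => Finset.prod_congr rfl fun i _ => ?_) f
  by_cases hi : i = Fin.last m
  · subst hi
    rw [lastRefl, signRefl_apply_same, h, inv_zpow, zpow_neg]
  · rw [lastRefl, signRefl_apply_of_ne hi, h' i hi]

lemma evalHom_demazureLusztig {m : ℕ} (t : ℂ) (j : Fin m) (x : Fin (m + 1) → ℂ)
    (hx : ∀ i, x i ≠ 0) (hne : x j.castSucc - x j.succ ≠ 0) (f : LaurentPoly (m + 1)) :
    evalHom x hx (demazureLusztig t j f) = t * evalHom x hx f +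
      (x j.castSucc - t * x j.succ) / (x j.castSucc - x j.succ) *
        (evalHom x hx (act (simpleRefl j) f) - evalHom x hx f) := by
  have h := congrArg (evalHom x hx) (mul_dividedDiff (simpleRefl j) (X j.castSucc - X j.succ)
    (X_sub_X_ne_zero j) (dvd_simpleRefl j) f)
  rw [map_mul, map_sub, map_sub, evalHom_X, evalHom_X] at h
  rw [← h]
  simp only [demazureLusztig, LinearMap.add_apply, LinearMap.smul_apply, LinearMap.id_apply,
    LinearMap.comp_apply, LinearMap.mulLeft_apply, map_add, map_smul, map_mul, map_sub, evalHom_X,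
    smul_eq_mul]
  field_simp

lemma evalHom_demazureLusztigLast {m : ℕ} (s : ℂ) (x : Fin (m + 1) → ℂ)
    (hx : ∀ i, x i ≠ 0) (hne : 1 - (x (Fin.last m))⁻¹ ^ 2 ≠ 0) (f : LaurentPoly (m + 1)) :
    evalHom x hx (demazureLusztigLast m s f) = -evalHom x hx f +
      (1 - s * (x (Fin.last m))⁻¹) * (1 - s⁻¹ * (x (Fin.last m))⁻¹) /
        (1 - (x (Fin.last m))⁻¹ ^ 2) *
          (evalHom x hx (act (lastRefl m) f) - evalHom x hx f) := by
  have h := congrArg (evalHom x hx) (mul_dividedDiff (lastRefl m) (1 - Xinv (Fin.last m) ^ 2)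
    (one_sub_Xinv_sq_ne_zero (Fin.last m)) dvd_lastRefl f)
  rw [map_mul, map_sub, map_sub, map_one, map_pow, evalHom_Xinv] at h
  rw [← h]
  simp only [demazureLusztigLast, LinearMap.add_apply, LinearMap.neg_apply, LinearMap.id_apply,
    LinearMap.comp_apply, LinearMap.mulLeft_apply, map_add, map_neg, map_smul, map_mul, map_sub,
    map_one, evalHom_Xinv, smul_eq_mul]
  rw [div_mul_eq_mul_div, mul_left_comm _ (1 - _), mul_div_cancel_left₀ _ hne]


/-! ### The interpolation points under the simple reflections -/

lemma interpPoint_of_nonneg {n : ℕ} (q s t : ℂ) {γ : Fin n → ℤ} {i : Fin n} (h : 0 ≤ γ i) :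
    interpPoint q (principalPoint s t) γ i = q ^ (γ i).natAbs * s * t ^ corank γ i := by
  rw [interpPoint_apply, sgn, if_pos h, zpow_one]

lemma interpPoint_of_neg {n : ℕ} (q s t : ℂ) {γ : Fin n → ℤ} {i : Fin n} (h : γ i < 0) :
    interpPoint q (principalPoint s t) γ i = (q ^ (γ i).natAbs * s * t ^ corank γ i)⁻¹ := by
  rw [interpPoint_apply, sgn, if_neg h.not_ge, zpow_neg_one]

lemma interpPoint_swap {m : ℕ} (q s t : ℂ) (j : Fin m) (γ : Fin (m + 1) → ℤ)
    (h : simpleRefl j γ ≠ γ) (i : Fin (m + 1)) :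
    interpPoint q (principalPoint s t) γ (Equiv.swap j.castSucc j.succ i) =
      interpPoint q (principalPoint s t) (simpleRefl j γ) i := by
  rw [interpPoint_apply, interpPoint_apply,
    corank_simpleRefl j γ ((simpleRefl_eq_self_iff j γ).not.mp h), simpleRefl_apply]

lemma interpPoint_lastRefl_of_ne {m : ℕ} (q s t : ℂ) (γ : Fin (m + 1) → ℤ) (i : Fin (m + 1))
    (h : i ≠ Fin.last m) :
    interpPoint q (principalPoint s t) (lastRefl m γ) i =
      interpPoint q (principalPoint s t) γ i := by
  rw [interpPoint_apply, interpPoint_apply, lastRefl, corank_signRefl_last, signRefl_apply_of_ne h]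

lemma lastRefl_eq_self_iff {m : ℕ} (γ : Fin (m + 1) → ℤ) :
    lastRefl m γ = γ ↔ γ (Fin.last m) = 0 := by
  constructor
  · intro h
    have := congrFun h (Fin.last m)
    rw [lastRefl, signRefl_apply_same] at this
    omega
  · intro h
    ext i
    by_cases hi : i = Fin.last m
    · subst hi; rw [lastRefl, signRefl_apply_same, h, neg_zero]
    · rw [lastRefl, signRefl_apply_of_ne hi]

lemma interpPoint_lastRefl_last {m : ℕ} (q s t : ℂ) (γ : Fin (m + 1) → ℤ)
    (h : γ (Fin.last m) ≠ 0) :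
    interpPoint q (principalPoint s t) (lastRefl m γ) (Fin.last m) =
      (interpPoint q (principalPoint s t) γ (Fin.last m))⁻¹ := by
  rw [interpPoint_apply, interpPoint_apply, lastRefl, corank_signRefl_last, signRefl_apply_same,
    Int.natAbs_neg, ← zpow_neg]
  congr 1
  unfold sgn
  split_ifs <;> omega

/-- A zero in the last position is listed last: its absolute value is minimal, and other zeros
precede it by position. -/
lemma corank_last_of_eq_zero {m : ℕ} (γ : Fin (m + 1) → ℤ) (h : γ (Fin.last m) = 0) :
    corank γ (Fin.last m) = 0 := by
  classical
  rw [corank, Finset.card_eq_zero, Finset.filter_eq_empty_iff]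
  intro j _
  rw [after_iff, h, Fin.val_last, abs_eq_max_neg]
  have := j.isLt
  simp only [abs_eq_max_neg]
  omega

lemma interpPoint_last_of_eq_zero {m : ℕ} (q s t : ℂ) (γ : Fin (m + 1) → ℤ)
    (h : γ (Fin.last m) = 0) : interpPoint q (principalPoint s t) γ (Fin.last m) = s := by
  rw [interpPoint_of_nonneg q s t h.ge, corank_last_of_eq_zero γ h, h]
  simp

/-- This makes the numerator of `H_j` vanish at points fixed by the reflection. For negative entries
the reversed listing order compensates the inversion. -/
lemma interpPoint_castSucc_of_eq {m : ℕ} (q s : ℂ) {t : ℂ} (ht0 : t ≠ 0) (j : Fin m)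
    (γ : Fin (m + 1) → ℤ) (h : simpleRefl j γ = γ) :
    interpPoint q (principalPoint s t) γ j.castSucc =
      t * interpPoint q (principalPoint s t) γ j.succ := by
  rw [simpleRefl_eq_self_iff] at h
  rcases le_or_gt 0 (γ j.castSucc) with h0 | h0
  · rw [interpPoint_of_nonneg q s t h0, interpPoint_of_nonneg q s t (h ▸ h0), h,
      corank_succ_of_nonneg j γ h h0]
    ring
  · rw [interpPoint_of_neg q s t h0, interpPoint_of_neg q s t (h ▸ h0), h,
      corank_succ_of_neg j γ h h0, pow_succ]
    field_simp

lemma corank_lt_of_after {n : ℕ} {γ : Fin n → ℤ} {i j : Fin n} (h : After γ i j) :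
    corank γ j < corank γ i := by
  classical
  refine Finset.card_lt_card (Finset.ssubset_iff_of_subset ?_ |>.mpr ⟨j, ?_, ?_⟩)
  · intro k hk
    rw [Finset.mem_filter] at hk ⊢
    exact ⟨hk.1, lt_trans h hk.2⟩
  · simpa using h
  · rw [Finset.mem_filter, not_and]
    exact fun _ => lt_irrefl _

lemma norm_interpParam_lt_one {q s t : ℂ} (hq1 : ‖q‖ < 1) (hs1 : ‖s‖ < 1) (ht1 : ‖t‖ < 1)
    (a k : ℕ) : ‖q ^ a * s * t ^ k‖ < 1 := by
  rw [norm_mul, norm_mul, norm_pow, norm_pow]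
  refine mul_lt_one_of_nonneg_of_lt_one_left (by positivity) ?_
    (pow_le_one₀ (norm_nonneg _) ht1.le)
  exact mul_lt_one_of_nonneg_of_lt_one_right (pow_le_one₀ (norm_nonneg _) hq1.le)
    (norm_nonneg _) hs1

lemma norm_interpParam_lt {q s t : ℂ} (hq0 : q ≠ 0) (hq1 : ‖q‖ < 1) (hs0 : s ≠ 0) (ht0 : t ≠ 0)
    (ht1 : ‖t‖ < 1) {a b k l : ℕ} (hab : b ≤ a) (hkl : l < k) :
    ‖q ^ a * s * t ^ k‖ < ‖q ^ b * s * t ^ l‖ := by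
  simp only [norm_mul, norm_pow]
  have hq := norm_pos_iff.mpr hq0
  have hs := norm_pos_iff.mpr hs0
  have ht := norm_pos_iff.mpr ht0
  refine mul_lt_mul' ?_ (pow_lt_pow_right_of_lt_one₀ ht ht1 hkl) (by positivity) (by positivity)
  exact mul_le_mul_of_nonneg_right (pow_le_pow_of_le_one hq.le hq1.le hab) hs.le

lemma ne_inv_of_norm_lt_one {x y : ℂ} (hx : ‖x‖ < 1) (hy : ‖y‖ < 1) (hy0 : y ≠ 0) :
    x ≠ y⁻¹ := by
  intro h
  rw [h, norm_inv] at hx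
  exact (one_lt_inv₀ (norm_pos_iff.mpr hy0)).mpr hy |>.not_gt hx

/-- Coordinates at nonnegative entries have norm below one, the others above one. Within one sign
class the norms before inversion drop strictly with the corank. -/
lemma interpPoint_injective {n : ℕ} {q s t : ℂ} (hq0 : q ≠ 0) (hq1 : ‖q‖ < 1) (hs0 : s ≠ 0)
    (hs1 : ‖s‖ < 1) (ht0 : t ≠ 0) (ht1 : ‖t‖ < 1) (γ : Fin n → ℤ) :
    Function.Injective (interpPoint q (principalPoint s t) γ) := by
  intro i j hij
  by_contra hne
  wlog haf : After γ i j generalizing i j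
  · refine this hij.symm (Ne.symm hne) ?_
    exact lt_of_le_of_ne (not_lt.mp haf) fun h => hne (sortKey_injective γ h).symm
  have hab : (γ j).natAbs ≤ (γ i).natAbs := by
    have := (after_iff γ i j).mp haf
    simp only [abs_eq_max_neg] at this
    omega
  have hlt := norm_interpParam_lt hq0 hq1 hs0 ht0 ht1 hab (corank_lt_of_after haf)
  have h1 := norm_interpParam_lt_one hq1 hs1 ht1
  have h0 : ∀ a k, q ^ a * s * t ^ k ≠ 0 := fun a k =>
    mul_ne_zero (mul_ne_zero (pow_ne_zero _ hq0) hs0) (pow_ne_zero _ ht0)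
  rcases le_or_gt 0 (γ i) with hi | hi <;> rcases le_or_gt 0 (γ j) with hj | hj
  · rw [interpPoint_of_nonneg q s t hi, interpPoint_of_nonneg q s t hj] at hij
    rw [hij] at hlt
    exact lt_irrefl _ hlt
  · rw [interpPoint_of_nonneg q s t hi, interpPoint_of_neg q s t hj] at hij
    exact ne_inv_of_norm_lt_one (h1 _ _) (h1 _ _) (h0 _ _) hij
  · rw [interpPoint_of_neg q s t hi, interpPoint_of_nonneg q s t hj] at hij
    exact ne_inv_of_norm_lt_one (h1 _ _) (h1 _ _) (h0 _ _) hij.symm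
  · rw [interpPoint_of_neg q s t hi, interpPoint_of_neg q s t hj, inv_inj] at hij
    rw [hij] at hlt
    exact lt_irrefl _ hlt

lemma one_sub_interpPoint_sq_ne_zero {n : ℕ} {q s t : ℂ} (hq1 : ‖q‖ < 1) (hs1 : ‖s‖ < 1)
    (ht1 : ‖t‖ < 1) (γ : Fin n → ℤ) (i : Fin n) :
    1 - interpPoint q (principalPoint s t) γ i ^ 2 ≠ 0 := by
  have h1 := norm_interpParam_lt_one hq1 hs1 ht1 (γ i).natAbs (corank γ i)
  intro h
  have h2 : q ^ (γ i).natAbs * s * t ^ corank γ i *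
      (q ^ (γ i).natAbs * s * t ^ corank γ i) = 1 := by
    rcases le_or_gt 0 (γ i) with hi | hi
    · rw [interpPoint_of_nonneg q s t hi] at h
      linear_combination -h
    · rw [interpPoint_of_neg q s t hi, sub_eq_zero, inv_pow, eq_comm, inv_eq_one] at h
      rw [← pow_two, h]
  have h3 := mul_lt_one_of_nonneg_of_lt_one_left (norm_nonneg _) h1 h1.le
  rw [← norm_mul, h2, norm_one] at h3
  exact lt_irrefl _ h3

lemma evalAt_G {n : ℕ} {q s t : ℂ} (hq0 : q ≠ 0) (hq1 : ‖q‖ < 1) (hs0 : s ≠ 0)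
    (hs1 : ‖s‖ < 1) (ht0 : t ≠ 0) (ht1 : ‖t‖ < 1) (α β : Fin n → ℤ) (h : weight β ≤ weight α) :
    evalHom (interpPoint q (principalPoint s t) β) (interpPoint_ne_zero hq0 hs0 ht0 β)
      (G q s t α) = if β = α then 1 else 0 := by
  have hG := isInterp_G hq0 hq1 hs0 hs1 ht0 ht1 α
  rw [evalHom_apply]
  split_ifs with hβ
  · rw [hβ]; exact hG.2.1
  · exact hG.2.2 β h hβ

lemma evalHom_congr {n : ℕ} {x y : Fin n → ℂ} (hx : ∀ i, x i ≠ 0) (hy : ∀ i, y i ≠ 0)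
    (h : x = y) (f : LaurentPoly n) : evalHom x hx f = evalHom y hy f := by
  subst h; rfl

/-! ### The Hecke operators on interpolation polynomials, compared point by point. -/

section Operators

variable {m : ℕ} {q s t : ℂ}

theorem demazureLusztig_G_of_eq (hq0 : q ≠ 0) (hq1 : ‖q‖ < 1) (hs0 : s ≠ 0)
    (hs1 : ‖s‖ < 1) (ht0 : t ≠ 0) (ht1 : ‖t‖ < 1) (α : Fin (m + 1) → ℤ) (j : Fin m)
    (h : simpleRefl j α = α) : demazureLusztig t j (G q s t α) = t • G q s t α := by
  have hG := mem_degSubmodule.mpr (isInterp_G hq0 hq1 hs0 hs1 ht0 ht1 α).1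
  refine eq_of_evalAt_eq hq0 hq1 hs0 hs1 ht0 ht1 (demazureLusztig_mem t j hG)
    (Submodule.smul_mem _ _ hG) fun β hβ => ?_
  have hx := interpPoint_ne_zero hq0 hs0 ht0 β
  have hne := sub_ne_zero.mpr ((interpPoint_injective hq0 hq1 hs0 hs1 ht0 ht1 β).ne
    (Fin.castSucc_lt_succ (i := j)).ne)
  rw [← evalHom_apply _ hx, ← evalHom_apply _ hx, map_smul, smul_eq_mul,
    evalHom_demazureLusztig t j _ hx hne]
  by_cases hβj : simpleRefl j β = β
  · rw [interpPoint_castSucc_of_eq q s ht0 j β hβj]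
    ring
  · have h1 : β ≠ α := fun e => hβj (e ▸ h)
    have h2 : simpleRefl j β ≠ α := fun e => h1 (by rw [← simpleRefl_simpleRefl j β, e, h])
    rw [evalHom_act_simpleRefl, evalHom_congr _ (interpPoint_ne_zero hq0 hs0 ht0 _)
      (funext (interpPoint_swap q s t j β hβj)), evalAt_G hq0 hq1 hs0 hs1 ht0 ht1 _ _ hβ,
      evalAt_G hq0 hq1 hs0 hs1 ht0 ht1 _ _ ((weight_simpleRefl j β).trans_le hβ), if_neg h1,
      if_neg h2]
    ring

theorem demazureLusztig_G_of_ne (hq0 : q ≠ 0) (hq1 : ‖q‖ < 1) (hs0 : s ≠ 0)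
    (hs1 : ‖s‖ < 1) (ht0 : t ≠ 0) (ht1 : ‖t‖ < 1) (α : Fin (m + 1) → ℤ) (j : Fin m)
    (h : simpleRefl j α ≠ α) (a : Fin (m + 1) → ℂ)
    (ha : a = interpPoint q (principalPoint s t) α) :
    demazureLusztig t j (G q s t α) = -G q s t α +
      ((a j.succ - t * a j.castSucc) / (a j.succ - a j.castSucc)) •
        (G q s t (simpleRefl j α) + G q s t α) := by
  have hG := mem_degSubmodule.mpr (isInterp_G hq0 hq1 hs0 hs1 ht0 ht1 α).1
  have hG' := mem_degSubmodule.mpr (isInterp_G hq0 hq1 hs0 hs1 ht0 ht1 (simpleRefl j α)).1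
  rw [weight_simpleRefl] at hG'
  refine eq_of_evalAt_eq hq0 hq1 hs0 hs1 ht0 ht1 (demazureLusztig_mem t j hG)
    (add_mem (neg_mem hG) (Submodule.smul_mem _ _ (add_mem hG' hG))) fun β hβ => ?_
  have hx := interpPoint_ne_zero hq0 hs0 ht0 β
  have hne := sub_ne_zero.mpr ((interpPoint_injective hq0 hq1 hs0 hs1 ht0 ht1 β).ne
    (Fin.castSucc_lt_succ (i := j)).ne)
  have hsα : simpleRefl j (simpleRefl j α) ≠ simpleRefl j α := by
    rw [simpleRefl_simpleRefl]; exact Ne.symm h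
  rw [← evalHom_apply _ hx, ← evalHom_apply _ hx, evalHom_demazureLusztig t j _ hx hne, map_add,
    map_neg, map_smul, map_add, smul_eq_mul, evalAt_G hq0 hq1 hs0 hs1 ht0 ht1 _ _ hβ,
    evalAt_G hq0 hq1 hs0 hs1 ht0 ht1 _ _ (hβ.trans_eq (weight_simpleRefl j α).symm)]
  by_cases hβj : simpleRefl j β = β
  · have h1 : β ≠ α := fun e => h (e ▸ hβj)
    have h2 : β ≠ simpleRefl j α := fun e => hsα (e ▸ hβj)
    rw [interpPoint_castSucc_of_eq q s ht0 j β hβj, if_neg h1, if_neg h2]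
    ring
  · rw [evalHom_act_simpleRefl, evalHom_congr _ (interpPoint_ne_zero hq0 hs0 ht0 _)
      (funext (interpPoint_swap q s t j β hβj)),
      evalAt_G hq0 hq1 hs0 hs1 ht0 ht1 _ _ ((weight_simpleRefl j β).trans_le hβ)]
    by_cases h1 : β = α
    · subst h1
      rw [← ha] at hne ⊢
      have hne' : a j.succ - a j.castSucc ≠ 0 := by rw [← neg_sub]; exact neg_ne_zero.mpr hne
      rw [if_pos rfl, if_neg h, if_neg (Ne.symm h)]
      field_simp
      ring
    · by_cases h2 : β = simpleRefl j α
      · have e1 : interpPoint q (principalPoint s t) β j.castSucc = a j.succ := by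
          rw [h2, ← interpPoint_swap q s t j α h, Equiv.swap_apply_left, ha]
        have e2 : interpPoint q (principalPoint s t) β j.succ = a j.castSucc := by
          rw [h2, ← interpPoint_swap q s t j α h, Equiv.swap_apply_right, ha]
        rw [e1, e2, if_neg h1, if_pos h2, if_pos (by rw [h2, simpleRefl_simpleRefl])]
        ring
      · have h3 : simpleRefl j β ≠ α := fun e => h2 (by rw [← e, simpleRefl_simpleRefl])
        rw [if_neg h1, if_neg h2, if_neg h3]
        ring

theorem demazureLusztigLast_G (hq0 : q ≠ 0) (hq1 : ‖q‖ < 1) (hs0 : s ≠ 0)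
    (hs1 : ‖s‖ < 1) (ht0 : t ≠ 0) (ht1 : ‖t‖ < 1) (α : Fin (m + 1) → ℤ) (a : Fin (m + 1) → ℂ)
    (ha : a = interpPoint q (principalPoint s t) α) :
    demazureLusztigLast m s (G q s t α) = -G q s t α +
      ((1 - s * a (Fin.last m)) * (1 - s⁻¹ * a (Fin.last m)) / (1 - a (Fin.last m) ^ 2)) •
        (G q s t (lastRefl m α) + G q s t α) := by
  have hG := mem_degSubmodule.mpr (isInterp_G hq0 hq1 hs0 hs1 ht0 ht1 α).1
  have hG' := mem_degSubmodule.mpr (isInterp_G hq0 hq1 hs0 hs1 ht0 ht1 (lastRefl m α)).1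
  rw [weight_lastRefl] at hG'
  refine eq_of_evalAt_eq hq0 hq1 hs0 hs1 ht0 ht1 (demazureLusztigLast_mem s hG)
    (add_mem (neg_mem hG) (Submodule.smul_mem _ _ (add_mem hG' hG))) fun β hβ => ?_
  have hx := interpPoint_ne_zero hq0 hs0 ht0 β
  have hsq := one_sub_interpPoint_sq_ne_zero hq1 hs1 ht1 β (Fin.last m)
  have hne : 1 - (interpPoint q (principalPoint s t) β (Fin.last m))⁻¹ ^ 2 ≠ 0 := by
    rw [inv_pow, sub_ne_zero]
    intro h
    exact hsq (sub_eq_zero.mpr (inv_eq_one.mp h.symm).symm)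
  rw [← evalHom_apply _ hx, ← evalHom_apply _ hx, evalHom_demazureLusztigLast s _ hx hne, map_add,
    map_neg, map_smul, map_add, smul_eq_mul, evalAt_G hq0 hq1 hs0 hs1 ht0 ht1 _ _ hβ,
    evalAt_G hq0 hq1 hs0 hs1 ht0 ht1 _ _ (hβ.trans_eq (weight_lastRefl α).symm)]
  by_cases hβ0 : β (Fin.last m) = 0
  -- Here `β̄_n = s`, so the numerator `1 - s / x_n` vanishes on the left; if `β = α`, the factor `1
  -- - s⁻¹ * a_n` vanishes on the right as well.
  · rw [interpPoint_last_of_eq_zero q s t β hβ0, mul_inv_cancel₀ hs0]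
    by_cases h1 : β = α
    · have e : a (Fin.last m) = s := by
        rw [ha, ← h1, interpPoint_last_of_eq_zero q s t β hβ0]
      rw [e, inv_mul_cancel₀ hs0]
      ring
    · have h2 : β ≠ lastRefl m α := by
        intro e
        apply h1
        rw [e, lastRefl_eq_self_iff]
        rw [e, lastRefl, signRefl_apply_same] at hβ0
        omega
      rw [if_neg h1, if_neg h2]
      ring
  · have hβr := (lastRefl_eq_self_iff β).not.mpr hβ0
    rw [evalHom_act_lastRefl _ hx _ (interpPoint_ne_zero hq0 hs0 ht0 (lastRefl m β))
      (interpPoint_lastRefl_last q s t β hβ0) (interpPoint_lastRefl_of_ne q s t β),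
      evalAt_G hq0 hq1 hs0 hs1 ht0 ht1 _ _ ((weight_lastRefl β).trans_le hβ)]
    by_cases h1 : β = α
    · subst h1
      have h0 := hx (Fin.last m)
      rw [← ha] at hsq hne h0 ⊢
      rw [if_pos rfl, if_neg hβr, if_neg (Ne.symm hβr)]
      have hsq' : a (Fin.last m) ^ 2 - 1 ≠ 0 := by rw [← neg_sub]; exact neg_ne_zero.mpr hsq
      field_simp
      ring
    · by_cases h2 : β = lastRefl m α
      · have h3 : lastRefl m β = α := by rw [h2, lastRefl_lastRefl]
        have e : (interpPoint q (principalPoint s t) β (Fin.last m))⁻¹ = a (Fin.last m) := by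
          rw [← interpPoint_lastRefl_last q s t β hβ0, h3, ha]
        rw [e, if_neg h1, if_pos h2, if_pos h3]
        ring
      · have h3 : lastRefl m β ≠ α := fun e => h2 (by rw [← e, lastRefl_lastRefl])
        rw [if_neg h1, if_neg h2, if_neg h3]
        ring

end Operators

end

end NonsymInterp

theorem mainTheorem4 (m : ℕ) (q s t : ℂ)
    (hq0 : 0 < ‖q‖) (hq1 : ‖q‖ < 1) (hs0 : 0 < ‖s‖) (hs1 : ‖s‖ < 1)
    (ht0 : 0 < ‖t‖) (ht1 : ‖t‖ < 1) (α : Fin (m + 1) → ℤ)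
    (a : Fin (m + 1) → ℂ)
    (ha : a = interpPoint q (principalPoint s t) α) :
    -- `G_α` is the unique solution of the interpolation problem of degree `α`
    (IsInterp q (principalPoint s t) α (G q s t α) ∧
      ∀ f : LaurentPoly (m + 1),
        IsInterp q (principalPoint s t) α f →
          f = G q s t α) ∧
    -- the operators `H_j` with `1 ≤ j < n`, where `n = m + 1`
    (∀ j : Fin m,
      (simpleRefl j α = α →
        demazureLusztig t j (G q s t α) =
          t • G q s t α) ∧
      (simpleRefl j α ≠ α →
        a j.succ - a j.castSucc ≠ 0 ∧
        demazureLusztig t j (G q s t α) =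
          -G q s t α +
            ((a j.succ - t * a j.castSucc) / (a j.succ - a j.castSucc)) •
              (G q s t (simpleRefl j α) +
                G q s t α))) ∧
    -- the operator `H_n`
    (1 - a (Fin.last m) ^ 2 ≠ 0 ∧
      demazureLusztigLast m s (G q s t α) =
        -G q s t α +
          ((1 - s * a (Fin.last m)) * (1 - s⁻¹ * a (Fin.last m)) / (1 - a (Fin.last m) ^ 2)) •
            (G q s t (lastRefl m α) +
              G q s t α)) ∧
    -- in particular, the operator `H_n` when `s_n α = α`
    (lastRefl m α = α →
      demazureLusztigLast m s (G q s t α) =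
        -G q s t α) := by
  have hq := norm_pos_iff.mp hq0
  have hs := norm_pos_iff.mp hs0
  have ht := norm_pos_iff.mp ht0
  have hH := demazureLusztigLast_G hq hq1 hs hs1 ht ht1 α a ha
  refine ⟨⟨isInterp_G hq hq1 hs hs1 ht ht1 α, fun f hf => ?_⟩, fun j => ⟨fun h =>
    demazureLusztig_G_of_eq hq hq1 hs hs1 ht ht1 α j h, fun h => ⟨?_,
    demazureLusztig_G_of_ne hq hq1 hs hs1 ht ht1 α j h a ha⟩⟩, ⟨?_, hH⟩, fun h => ?_⟩
  · have hG := isInterp_G hq hq1 hs hs1 ht ht1 α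
    refine eq_of_evalAt_eq hq hq1 hs hs1 ht ht1 (mem_degSubmodule.mpr hf.1)
      (mem_degSubmodule.mpr hG.1) fun β hβ => ?_
    by_cases h : β = α
    · rw [h, hf.2.1, hG.2.1]
    · rw [hf.2.2 β hβ h, hG.2.2 β hβ h]
  · rw [ha, sub_ne_zero]
    exact (interpPoint_injective hq hq1 hs hs1 ht ht1 α).ne (Fin.castSucc_lt_succ).ne'
  · rw [ha]
    exact one_sub_interpPoint_sq_ne_zero hq1 hs1 ht1 α _
  -- A fixed `α` has last entry zero, so `ᾱ_n = s` annihilates the coefficient in the general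
  -- formula.
  · have e : a (Fin.last m) = s := by
      rw [ha, interpPoint_last_of_eq_zero q s t α ((lastRefl_eq_self_iff α).mp h)]
    rw [hH, e, inv_mul_cancel₀ hs, sub_self, mul_zero, zero_div, zero_smul, add_zero]
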